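/- Let $M$ be a matrix with $t$ columns and $u$ rows ($t,u\ge 0$), all of whose entries are in $\{0,1,-1\}$; write $M_{i,j}$ for the entry in column $i$ (from the left) and row $j$ (from the bottom). An $M$-gridding of a permutation $\sigma$ of $\{1,\dots,k\}$ is a pair of sequences $\frac12=c_0\le c_1\le\dots\le c_t=k+\frac12$ and $\frac12=r_0\le r_1\le\dots\le r_u=k+\frac12$, all of whose terms lie in $\{\frac12,\frac32,\dots,k+\frac12\}$, such that for all $i\in\{1,\dots,t\}$, $j\in\{1,\dots,u\}$ the subsequence of $\sigma$ with indices between $c_{i-1}$ and $c_i$ and values between $r_{j-1}$ and $r_j$ is increasing if $M_{i,j}=1$, decreasing if $M_{i,j}=-1$, and empty if $M_{i,j}=0$. The (monotone) grid class $\mathrm{Grid}(M)$ is the set of all permutations that have an $M$-gridding; its size is the number of non-zero entries of $M$. Its row-column graph is the bipartite graph with one vertex for each row and one for each column of $M$, in which the vertex of row $j$ and the vertex of column $i$ are adjacent if and only if $M_{i,j}\ne 0$. The grid class is connected if this graph is connected (in particular non-empty). The growth rate of $\mathrm{Grid}(M)$ is $\lim_{k\to\infty}|\mathrm{Grid}_k(M)|^{1/k}$,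 if this limit exists, where $\mathrm{Grid}_k(M)$ is the set of permutations of length $k$ in $\mathrm{Grid}(M)$. Let $m\ge 0$ be an integer. Then every grid class of size $m$ whose row-column graph is a path (with at least one vertex) has a growth rate, and it equals $4\cos^2\!\left(\frac{\pi}{m+2}\right)$. Moreover, every connected grid class of size $m$ has a growth rate, and $4\cos^2\!\left(\frac{\pi}{m+2}\right)$ is the minimum of the growth rates of all connected grid classes of size $m$. -/

import Mathlib

open Filter Topology

namespace GridClass

/-- A `0/±1` matrix with `t` columns and `u` rows. Entries are indexed from the lower left corner,
column first: `M i j` is the entry in column `i` (from the left) and row `j` (from the bottom).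
`SignType` is exactly the three-element type `{0, 1, -1}`. -/
abbrev CellMatrix (t u : ℕ) : Type := Matrix (Fin t) (Fin u) SignType

/-- An `M`-gridding of a permutation `σ` of length `k`. Points are numbered from `0`, and the
dividers, which are half-integers `d + 1/2` with `d ∈ {0, …, k}`, are recorded by the
natural number `d`: the positions `a` between the column dividers `c i.castSucc` and `c i.succ` are
those with `c i.castSucc ≤ a < c i.succ`, and similarly for values and row dividers. -/
structure Gridding {t u : ℕ} (M : CellMatrix t u) {k : ℕ} (σ : Equiv.Perm (Fin k)) where
  /-- the column dividers -/
  c : Fin (t + 1) → ℕ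
  /-- the row dividers -/
  r : Fin (u + 1) → ℕ
  c_mono : Monotone c
  r_mono : Monotone r
  c_zero : c 0 = 0
  c_last : c (Fin.last t) = k
  r_zero : r 0 = 0
  r_last : r (Fin.last u) = k
  increasing : ∀ i j, M i j = 1 → StrictMonoOn σ
    {a | c i.castSucc ≤ a ∧ a < c i.succ ∧ r j.castSucc ≤ σ a ∧ σ a < r j.succ}
  decreasing : ∀ i j, M i j = -1 → StrictAntiOn σ
    {a | c i.castSucc ≤ a ∧ a < c i.succ ∧ r j.castSucc ≤ σ a ∧ σ a < r j.succ}
  empty : ∀ i j, M i j = 0 →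
    {a : Fin k | c i.castSucc ≤ a ∧ a < c i.succ ∧ r j.castSucc ≤ σ a ∧ σ a < r j.succ} = ∅

/-- The monotone grid class of `M`, given by its set of permutations of each length `k`:
those that have an `M`-gridding. -/
def Grid {t u : ℕ} (M : CellMatrix t u) (k : ℕ) : Set (Equiv.Perm (Fin k)) :=
  {σ | Nonempty (Gridding M σ)}

/-- The size of the grid class of `M`: the number of non-zero entries of `M`. -/
def size {t u : ℕ} (M : CellMatrix t u) : ℕ :=
  (Finset.univ.filter fun p : Fin t × Fin u => M p.1 p.2 ≠ 0).card

/-- The row-column graph of `M`: one vertex for each column (`Sum.inl i`) and each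
row (`Sum.inr j`), column `i` and row `j` being adjacent if and only if `M i j ≠ 0`. -/
def rowColumnGraph {t u : ℕ} (M : CellMatrix t u) : SimpleGraph (Fin t ⊕ Fin u) where
  Adj
    | Sum.inl i, Sum.inr j => M i j ≠ 0
    | Sum.inr j, Sum.inl i => M i j ≠ 0
    | _, _ => False
  symm := ⟨by rintro (i | j) (i' | j') h <;> exact h⟩
  loopless := ⟨by rintro (i | j) h <;> exact h⟩

/-- A graph is a path if it is isomorphic to the path graph on `n + 1` vertices for some `n`. -/
def IsPathGraph {V : Type*} (G : SimpleGraph V) : Prop :=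
  ∃ n : ℕ, Nonempty (G ≃g SimpleGraph.pathGraph (n + 1))

/-- A collection of permutations (given by the set of its members of each length `k`) has
growth rate `g`: its upper and lower growth rates coincide and equal the real number `g`,
that is, `|C k| ^ (1 / k)` tends to `g`. -/
def HasGrowthRate (C : ∀ k : ℕ, Set (Equiv.Perm (Fin k))) (g : ℝ) : Prop :=
  Tendsto (fun k : ℕ => ((C k).ncard : ℝ) ^ (1 / (k : ℝ))) atTop (𝓝 g)

end GridClass

/-! The growth rate of a non-trivial connected class is the square of the spectral radius of its
row-column graph, so the theorem reduces to spectral graph theory.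

Fix the block labels of positions and values. A compatible `σ` is determined by the row labels `row
∘ σ` along positions and the column labels `col ∘ σ.symm` along values
(`Compatible.eq_of_labels_eq`). Given an adjacency eigenvector with positive column entries `x`, row
entries `y` and eigenvalue `l > 0`, weight these label words by the transition probabilities `y j /
(l * x i)` and `x i / (l * y j)`. The total weight is at most 1 and each `σ` has weight `l ^ (-2 *
k)`, so at most `l ^ (2 * k)` permutations occur per gridding, and there are only polynomially many
griddings. Conversely, placing a fraction of points proportional to `x i * y j` in each non-zero
cell gives a product of multinomials whose exponential rate, by Stirling, is `2 * log l`. Both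
bounds meet in `hasGrowthRate_sq_of_eigenvector`; connected graphs have a positive eigenvector by
Perron–Frobenius.

On a path with `m` edges the sine vector gives `l = 2 * cos (π / (m + 2))`. For the minimum, a
connected graph with `m` edges that is not a tree has average degree at least 2, hence `l ≥ 2`. For
a tree, `sinRatio_mul_le_adjSum` compares any positive vector that is superharmonic off a root with
the sine vector of a path, by cutting an edge at the root; the key inequality is the subadditivity
`sinRatio_add_le`. -/

namespace GridClass

open scoped Nat

/-! ### Griddings as monotone block labellings -/

/-- A permutation is compatible with an assignment of its positions to columns and of its values to
rows if its points are monotone within each cell as prescribed by `M`. -/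
structure Compatible {t u k : ℕ} (M : CellMatrix t u) (col : Fin k → Fin t) (row : Fin k → Fin u)
    (σ : Equiv.Perm (Fin k)) : Prop where
  increasing : ∀ i j, M i j = 1 → StrictMonoOn σ {a | col a = i ∧ row (σ a) = j}
  decreasing : ∀ i j, M i j = -1 → StrictAntiOn σ {a | col a = i ∧ row (σ a) = j}
  ne_zero : ∀ a, M (col a) (row (σ a)) ≠ 0

lemma exists_block {t k : ℕ} (c : Fin (t + 1) → ℕ) (hc : Monotone c) (h0 : c 0 = 0)
    (hl : c (Fin.last t) = k) :
    ∃ col : Fin k → Fin t, Monotone col ∧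
      ∀ (a : Fin k) (i : Fin t), (c i.castSucc ≤ a ∧ a < c i.succ) ↔ col a = i := by
  have ex : ∀ a : Fin k, ∃ i : Fin t, c i.castSucc ≤ a ∧ a < c i.succ := by
    intro a
    have key : ∀ i : Fin (t + 1), (a : ℕ) < c i → ∃ i : Fin t, c i.castSucc ≤ a ∧ a < c i.succ := by
      intro i
      induction i using Fin.induction with
      | zero => intro h; omega
      | succ i ih =>
        intro h
        by_cases h' : (a : ℕ) < c i.castSucc
        · exact ih h'
        · exact ⟨i, not_lt.mp h', h⟩
    exact key (Fin.last t) (by rw [hl]; exact a.2)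
  have lt : ∀ {a b : Fin k} {i j : Fin t}, a ≤ b → c i.castSucc ≤ a → b < c j.succ → i ≤ j := by
    intro a b i j hab hi hj
    by_contra! h
    have := hc (show j.succ ≤ i.castSucc from h)
    have : (a : ℕ) ≤ b := hab
    omega
  choose col hcol using ex
  refine ⟨col, fun a b hab => lt hab (hcol a).1 (hcol b).2, fun a i => ⟨fun h => ?_, ?_⟩⟩
  · exact le_antisymm (lt le_rfl (hcol a).1 h.2) (lt le_rfl h.1 (hcol a).2)
  · rintro rfl
    exact hcol a

/-- The number of positions assigned to one of the first `i` blocks. -/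
def dividers {t k : ℕ} (col : Fin k → Fin t) (i : Fin (t + 1)) : Fin (k + 1) :=
  ⟨(Finset.univ.filter fun p => (col p : ℕ) < i).card,
    Nat.lt_succ_of_le ((Finset.card_le_univ _).trans (by simp))⟩

/-- For monotone `col` the positions with label below `i` form an initial segment, so its
cardinality is also its end. -/
lemma lt_dividers_iff {t k : ℕ} {col : Fin k → Fin t} (h : Monotone col) (p : Fin k)
    (i : Fin (t + 1)) : (p : ℕ) < dividers col i ↔ (col p : ℕ) < i := by
  constructor
  · intro hp
    by_contra! hi
    have : (Finset.univ.filter fun q => (col q : ℕ) < i) ⊆ Finset.Iio p := by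
      intro q hq
      simp only [Finset.mem_filter, Finset.mem_univ, true_and, Finset.mem_Iio] at hq ⊢
      by_contra! hpq
      have : (col p : ℕ) ≤ col q := h hpq
      omega
    have := Finset.card_le_card this
    rw [Fin.card_Iio] at this
    simp only [dividers] at hp
    omega
  · intro hp
    have : Finset.Iic p ⊆ Finset.univ.filter fun q => (col q : ℕ) < i := by
      intro q hq
      simp only [Finset.mem_filter, Finset.mem_univ, true_and, Finset.mem_Iic] at hq ⊢
      have : (col q : ℕ) ≤ col p := h hq
      omega
    have := Finset.card_le_card this
    rw [Fin.card_Iic] at this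
    simp only [dividers]
    omega

lemma dividers_block_iff {t k : ℕ} {col : Fin k → Fin t} (h : Monotone col) (p : Fin k)
    (i : Fin t) :
    ((dividers col i.castSucc : ℕ) ≤ p ∧ (p : ℕ) < dividers col i.succ) ↔ col p = i := by
  rw [← not_lt, lt_dividers_iff h, lt_dividers_iff h, Fin.ext_iff]
  simp only [Fin.val_castSucc, Fin.val_succ]
  omega

lemma monotone_dividers {t k : ℕ} (col : Fin k → Fin t) :
    Monotone fun i => (dividers col i : ℕ) := by
  intro i j hij
  change (Finset.univ.filter fun p => (col p : ℕ) < i).card ≤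
    (Finset.univ.filter fun p => (col p : ℕ) < j).card
  refine Finset.card_le_card fun p hp => ?_
  simp only [Finset.mem_filter, Finset.mem_univ, true_and] at hp ⊢
  exact hp.trans_le hij

lemma dividers_zero {t k : ℕ} (col : Fin k → Fin t) : (dividers col 0 : ℕ) = 0 := by
  simp [dividers]

lemma dividers_last {t k : ℕ} (col : Fin k → Fin t) : (dividers col (Fin.last t) : ℕ) = k := by
  simp [dividers]

lemma mem_grid_iff {t u k : ℕ} {M : CellMatrix t u} {σ : Equiv.Perm (Fin k)} :
    σ ∈ Grid M k ↔ ∃ col row, Monotone col ∧ Monotone row ∧ Compatible M col row σ := by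
  constructor
  · rintro ⟨G⟩
    obtain ⟨col, hcol, hc⟩ := exists_block G.c G.c_mono G.c_zero G.c_last
    obtain ⟨row, hrow, hr⟩ := exists_block G.r G.r_mono G.r_zero G.r_last
    have e : ∀ i j, {a : Fin k | G.c i.castSucc ≤ a ∧ a < G.c i.succ ∧
        G.r j.castSucc ≤ σ a ∧ σ a < G.r j.succ} = {a | col a = i ∧ row (σ a) = j} := by
      intro i j
      ext a
      simp only [Set.mem_ofPred_eq]
      rw [← hc, ← hr, and_assoc]
    refine ⟨col, row, hcol, hrow, fun i j h => e i j ▸ G.increasing i j h,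
      fun i j h => e i j ▸ G.decreasing i j h, fun a h => ?_⟩
    have := G.empty _ _ h
    rw [e] at this
    exact (Set.eq_empty_iff_forall_notMem.mp this a) ⟨rfl, rfl⟩
  · rintro ⟨col, row, hcol, hrow, h⟩
    have e : ∀ i j, {a : Fin k | (dividers col i.castSucc : ℕ) ≤ a ∧ a < (dividers col i.succ : ℕ) ∧
        (dividers row j.castSucc : ℕ) ≤ σ a ∧ σ a < (dividers row j.succ : ℕ)} =
          {a | col a = i ∧ row (σ a) = j} := by
      intro i j
      ext a
      simp only [Set.mem_ofPred_eq]
      rw [← dividers_block_iff hcol, ← dividers_block_iff hrow, and_assoc]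
    refine ⟨⟨fun i => dividers col i, fun j => dividers row j, monotone_dividers col,
      monotone_dividers row, dividers_zero col, dividers_last col, dividers_zero row,
      dividers_last row, fun i j hM => e i j ▸ h.increasing i j hM,
      fun i j hM => e i j ▸ h.decreasing i j hM, fun i j hM => ?_⟩⟩
    rw [e, Set.eq_empty_iff_forall_notMem]
    rintro a ⟨rfl, rfl⟩
    exact h.ne_zero a hM

/-- A monotone labelling is recovered from its `t + 1` dividers, each with `k + 1` possible values.
Only polynomial growth in `k` matters. -/
lemma card_monotone_le (t k : ℕ) :
    Nat.card {col : Fin k → Fin t // Monotone col} ≤ (k + 1) ^ (t + 1) := by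
  have : Function.Injective
      (fun col : {col : Fin k → Fin t // Monotone col} => dividers col.1) := by
    rintro ⟨f, hf⟩ ⟨g, hg⟩ h
    ext1
    funext p
    simp only at h
    exact ((dividers_block_iff hg p _).mp (h ▸ (dividers_block_iff hf p _).mpr rfl)).symm
  refine (Nat.card_le_card_of_injective _ this).trans ?_
  simp

/-! ### Upper bound: weighting label words -/

lemma eqOn_of_strictMonoOn_of_image_eq {α β : Type*} [LinearOrder α] [Finite α] [PartialOrder β]
    {f g : α → β} {s : Set α} (hf : StrictMonoOn f s) (hg : StrictMonoOn g s)
    (h : f '' s = g '' s) : Set.EqOn f g s := by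
  have h1 : StrictMono (s.domRestrict f) := fun a b hab => hf a.2 b.2 hab
  have h2 : StrictMono (s.domRestrict g) := fun a b hab => hg a.2 b.2 hab
  have := (StrictMono.range_inj h1 h2).mp (by rw [Set.range_domRestrict, Set.range_domRestrict, h])
  exact fun a ha => congrFun this ⟨a, ha⟩

lemma eqOn_of_strictAntiOn_of_image_eq {α β : Type*} [LinearOrder α] [Finite α] [PartialOrder β]
    {f g : α → β} {s : Set α} (hf : StrictAntiOn f s) (hg : StrictAntiOn g s)
    (h : f '' s = g '' s) : Set.EqOn f g s := by
  intro a ha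
  exact OrderDual.toDual.injective (eqOn_of_strictMonoOn_of_image_eq (β := βᵒᵈ)
    (f := OrderDual.toDual ∘ f) (g := OrderDual.toDual ∘ g) hf.dual_right hg.dual_right
    (by rw [Set.image_comp, Set.image_comp, h]) ha)

/-- The two label words fix which positions and which values each cell occupies, and a bijection
between finite chains with prescribed direction of monotonicity is unique. -/
lemma Compatible.eq_of_labels_eq {t u k : ℕ} {M : CellMatrix t u} {col : Fin k → Fin t}
    {row : Fin k → Fin u} {σ τ : Equiv.Perm (Fin k)} (hσ : Compatible M col row σ)
    (hτ : Compatible M col row τ) (hrow : row ∘ σ = row ∘ τ) (hcol : col ∘ σ.symm = col ∘ τ.symm) :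
    σ = τ := by
  ext1 a
  set s := {b | col b = col a ∧ row (σ b) = row (σ a)}
  have hs : s = {b | col b = col a ∧ row (τ b) = row (σ a)} := by
    ext b
    have := congrFun hrow b
    simp only [Function.comp_apply] at this
    simp [s, this]
  have im : ∀ ρ : Equiv.Perm (Fin k), ρ '' {b | col b = col a ∧ row (ρ b) = row (σ a)} =
      {v | (col ∘ ρ.symm) v = col a ∧ row v = row (σ a)} := by
    intro ρ
    rw [Equiv.image_eq_preimage_symm]
    ext v
    simp
  have hi : σ '' s = τ '' s := by
    rw [im σ, hs, im τ, hcol]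
  have ha : a ∈ s := ⟨rfl, rfl⟩
  rcases SignType.trichotomy (M (col a) (row (σ a))) with h | h | h
  · exact eqOn_of_strictAntiOn_of_image_eq (hσ.decreasing _ _ h) 
      (show StrictAntiOn τ s by rw [hs]; exact hτ.decreasing _ _ h)  hi ha
  · exact absurd h (hσ.ne_zero a)
  · exact eqOn_of_strictMonoOn_of_image_eq (hσ.increasing _ _ h) 
      (show StrictMonoOn τ s by rw [hs]; exact hτ.increasing _ _ h)  hi ha

lemma sum_prod_weight_le_one {α β γ : Type*} [Fintype α] [DecidableEq α] [Fintype γ]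
    (q : β → γ → ℝ) (hq : ∀ i j, 0 ≤ q i j) (hs : ∀ i, ∑ j, q i j ≤ 1) (col : α → β) :
    ∑ f : α → γ, ∏ p, q (col p) (f p) ≤ 1 := by
  classical
  have := Finset.prod_univ_sum (fun _ : α => (Finset.univ : Finset γ)) (fun p j => q (col p) j)
  rw [Fintype.piFinset_univ] at this
  rw [← this]
  exact Finset.prod_le_one (fun p _ => Finset.sum_nonneg fun j _ => hq _ _) (fun p _ => hs _)

/-- Read `q` and `q'` as substochastic kernels. The pairs of label words have total weight at most
1, distinct permutations give distinct pairs, and each point of `σ`, seen once as a position and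
once as a value, contributes a factor at least `w`. -/
lemma card_compatible_mul_pow_le {t u k : ℕ} {M : CellMatrix t u} (q : Fin t → Fin u → ℝ)
    (q' : Fin u → Fin t → ℝ) (hq : ∀ i j, 0 ≤ q i j) (hq' : ∀ j i, 0 ≤ q' j i)
    (hs : ∀ i, ∑ j, q i j ≤ 1) (hs' : ∀ j, ∑ i, q' j i ≤ 1) {w : ℝ} (hw : 0 ≤ w)
    (hM : ∀ i j, M i j ≠ 0 → w ≤ q i j * q' j i) (col : Fin k → Fin t) (row : Fin k → Fin u) :
    (Nat.card {σ // Compatible M col row σ} : ℝ) * w ^ k ≤ 1 := by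
  classical
  let F : (Fin k → Fin u) × (Fin k → Fin t) → ℝ := fun fg =>
    (∏ p, q (col p) (fg.1 p)) * ∏ v, q' (row v) (fg.2 v)
  let e : {σ // Compatible M col row σ} → (Fin k → Fin u) × (Fin k → Fin t) := fun σ =>
    (row ∘ σ.1, col ∘ σ.1.symm)
  have he : Function.Injective e := by
    rintro ⟨σ, hσ⟩ ⟨τ, hτ⟩ h
    simp only [e, Prod.mk.injEq] at h
    exact Subtype.ext (hσ.eq_of_labels_eq hτ h.1 h.2)
  have hF : ∀ fg, 0 ≤ F fg := fun fg =>
    mul_nonneg (Finset.prod_nonneg fun _ _ => hq _ _) (Finset.prod_nonneg fun _ _ => hq' _ _)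
  have h1 : ∀ σ, w ^ k ≤ F (e σ) := by
    rintro ⟨σ, hσ⟩
    have h2 : ∏ v, q' (row v) (col (σ.symm v)) = ∏ p, q' (row (σ p)) (col p) := by
      rw [← Equiv.prod_comp σ]
      simp
    simp only [F, e, Function.comp_apply]
    rw [h2, ← Finset.prod_mul_distrib]
    calc w ^ k = ∏ _p : Fin k, w := by simp
      _ ≤ _ := Finset.prod_le_prod (fun _ _ => hw) fun p _ => hM _ _ (hσ.ne_zero p)
  calc (Nat.card {σ // Compatible M col row σ} : ℝ) * w ^ k
      = ∑ _σ : {σ // Compatible M col row σ}, w ^ k := by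
        simp [Nat.card_eq_fintype_card]
    _ ≤ ∑ σ, F (e σ) := Finset.sum_le_sum fun σ _ => h1 σ
    _ = ∑ fg ∈ Finset.univ.map ⟨e, he⟩, F fg := by simp
    _ ≤ ∑ fg, F fg := Finset.sum_le_sum_of_subset_of_nonneg (Finset.subset_univ _)
        fun fg _ _ => hF fg
    _ = (∑ f : Fin k → Fin u, ∏ p, q (col p) (f p)) *
          ∑ g : Fin k → Fin t, ∏ v, q' (row v) (g v) := by
        rw [Fintype.sum_mul_sum, Fintype.sum_prod_type]
    _ ≤ 1 * 1 := mul_le_mul (sum_prod_weight_le_one q hq hs col)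
        (sum_prod_weight_le_one q' hq' hs' row)
        (Finset.sum_nonneg fun _ _ => Finset.prod_nonneg fun _ _ => hq' _ _) zero_le_one
    _ = 1 := one_mul 1

lemma ncard_grid_mul_pow_le {t u : ℕ} {M : CellMatrix t u} (q : Fin t → Fin u → ℝ)
    (q' : Fin u → Fin t → ℝ) (hq : ∀ i j, 0 ≤ q i j) (hq' : ∀ j i, 0 ≤ q' j i)
    (hs : ∀ i, ∑ j, q i j ≤ 1) (hs' : ∀ j, ∑ i, q' j i ≤ 1) {w : ℝ} (hw : 0 ≤ w)
    (hM : ∀ i j, M i j ≠ 0 → w ≤ q i j * q' j i) (k : ℕ) :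
    ((Grid M k).ncard : ℝ) * w ^ k ≤ ((k : ℝ) + 1) ^ (t + 1 + (u + 1)) := by
  classical
  let A := {col : Fin k → Fin t // Monotone col}
  let B := {row : Fin k → Fin u // Monotone row}
  have h1 : (Grid M k).ncard ≤ ∑ p : A × B, Nat.card {σ // Compatible M p.1.1 p.2.1 σ} := by
    let F : (Σ p : A × B, {σ // Compatible M p.1.1 p.2.1 σ}) → Equiv.Perm (Fin k) := fun x => x.2.1
    have hsub : Grid M k ⊆ Set.range F := by
      intro σ hσ
      obtain ⟨col, row, hc, hr, h⟩ := mem_grid_iff.mp hσ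
      exact ⟨⟨(⟨col, hc⟩, ⟨row, hr⟩), ⟨σ, h⟩⟩, rfl⟩
    calc (Grid M k).ncard ≤ (Set.range F).ncard := Set.ncard_le_ncard hsub
      _ ≤ Nat.card (Σ p : A × B, {σ // Compatible M p.1.1 p.2.1 σ}) := by
          rw [← Set.image_univ, ← Set.ncard_univ]
          exact Set.ncard_image_le
      _ = _ := Nat.card_sigma
  calc ((Grid M k).ncard : ℝ) * w ^ k
      ≤ (∑ p : A × B, (Nat.card {σ // Compatible M p.1.1 p.2.1 σ} : ℝ)) * w ^ k := by
        gcongr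
        exact_mod_cast h1
    _ = ∑ p : A × B, (Nat.card {σ // Compatible M p.1.1 p.2.1 σ} : ℝ) * w ^ k := Finset.sum_mul ..
    _ ≤ ∑ _p : A × B, (1 : ℝ) := Finset.sum_le_sum fun p _ =>
        card_compatible_mul_pow_le q q' hq hq' hs hs' hw hM _ _
    _ = (Nat.card A : ℝ) * Nat.card B := by simp [Nat.card_eq_fintype_card]
    _ ≤ ((k : ℝ) + 1) ^ (t + 1) * ((k : ℝ) + 1) ^ (u + 1) := by
        gcongr
        · exact_mod_cast card_monotone_le t k
        · exact_mod_cast card_monotone_le u k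
    _ = _ := (pow_add ..).symm

/-! ### Lower bound: permutations with prescribed cell counts -/

/-- With `key` the first coordinate, one sorted word supplies both a monotone block labelling and an
initial labelling of the other kind with the right counts. -/
lemma exists_labels {β δ : Type*} [Fintype β] [LinearOrder δ] (key : β → δ) (a : β → ℕ) {k : ℕ}
    (hk : ∑ c, a c = k) :
    ∃ h : Fin k → β, Monotone (key ∘ h) ∧ ∀ c, Nat.card {p // h p = c} = a c := by
  classical
  let e : Fin k ≃ Σ c, Fin (a c) := (Fintype.equivFinOfCardEq (by simp [hk])).symm
  let h₀ : Fin k → β := fun p => (e p).1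
  refine ⟨h₀ ∘ Tuple.sort (key ∘ h₀), Tuple.monotone_sort (key ∘ h₀), fun c => ?_⟩
  have e₁ : {p // (h₀ ∘ Tuple.sort (key ∘ h₀)) p = c} ≃ {x : Σ c, Fin (a c) // x.1 = c} :=
    ((Tuple.sort (key ∘ h₀)).trans e).subtypeEquiv fun p => Iff.rfl
  rw [Nat.card_congr (e₁.trans (Equiv.sigmaSubtype c))]
  simp

lemma card_fiber_eq_sum {α β γ : Type*} [Finite α] [Fintype γ] (col : α → β) (f : α → γ)
    (i : β) : Nat.card {p // col p = i} = ∑ j, Nat.card {p // (col p, f p) = (i, j)} := by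
  classical
  have := Fintype.ofFinite α
  simp only [Nat.card_eq_fintype_card, Fintype.card_subtype]
  rw [Finset.card_eq_sum_card_fiberwise (f := f) (t := Finset.univ) (fun _ _ => by simp)]
  simp [Finset.filter_filter]

/-- A multinomial lower bound without division: permutations preserving `col` act on labellings by
`π ↦ f₀ ∘ π`, and each fibre of this map is no larger than the stabilizer of the pair `(col, f₀)`.
-/
lemma prod_factorial_le_card_labels {α β γ : Type*} [Finite α] [Fintype β] [Fintype γ]
    (col : α → β) (f₀ : α → γ) (a : β × γ → ℕ)
    (h₀ : ∀ c, Nat.card {p // (col p, f₀ p) = c} = a c) :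
    ∏ i, (∑ j, a (i, j))! ≤
      Nat.card {f : α → γ // ∀ c, Nat.card {p // (col p, f p) = c} = a c} * ∏ c, (a c)! := by
  classical
  have := Fintype.ofFinite α
  have hS : Fintype.card {π : Equiv.Perm α // col ∘ π = col} = ∏ i, (∑ j, a (i, j))! := by
    rw [DomMulAct.stabilizer_card]
    refine Finset.prod_congr rfl fun i _ => ?_
    rw [← Nat.card_eq_fintype_card, card_fiber_eq_sum col f₀]
    simp only [h₀]
  have hP : Fintype.card {π : Equiv.Perm α // (fun p => (col p, f₀ p)) ∘ π =
      fun p => (col p, f₀ p)} = ∏ c, (a c)! := by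
    rw [DomMulAct.stabilizer_card]
    refine Finset.prod_congr rfl fun c _ => ?_
    rw [← Nat.card_eq_fintype_card, h₀]
  let F : {π : Equiv.Perm α // col ∘ π = col} →
      {f : α → γ // ∀ c, Nat.card {p // (col p, f p) = c} = a c} := fun π =>
    ⟨f₀ ∘ π.1, fun c => by
      rw [← h₀ c]
      refine Nat.card_congr (π.1.subtypeEquiv fun p => ?_)
      rw [← congrFun π.2 p]
      rfl⟩
  rw [← hS, ← hP, Nat.card_eq_fintype_card, mul_comm, ← Finset.card_univ]
  refine (Finset.card_le_mul_card_image (f := F) Finset.univ _ ?_).trans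
    (Nat.mul_le_mul_left _ (Finset.card_le_univ _))
  intro f hf
  obtain ⟨⟨π₁, h₁⟩, -, hπ₁⟩ := Finset.mem_image.mp hf
  rw [← Finset.card_univ]
  -- Relative to a fixed `π₁` in the fibre, any other `π` there differs by a permutation preserving
  -- both `col` and `f₀`.
  have hmem : ∀ π ∈ Finset.univ.filter fun x => F x = f,
      (fun p => (col p, f₀ p)) ∘ (π₁.symm.trans π.1) = fun p => (col p, f₀ p) := by
    rintro ⟨π, h⟩ hπ
    have h2 : f₀ ∘ π = f₀ ∘ π₁ := by
      have := (Finset.mem_filter.mp hπ).2.trans hπ₁.symm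
      exact congrArg Subtype.val this
    funext p
    have h3 := congrFun h (π₁.symm p)
    have h4 := congrFun h₁ (π₁.symm p)
    have h5 := congrFun h2 (π₁.symm p)
    simp only [Function.comp_apply, Equiv.apply_symm_apply] at h3 h4 h5
    simp [h3, h4, h5]
  refine Finset.card_le_card_of_injOn
    (fun π => if h : (fun p => (col p, f₀ p)) ∘ (π₁.symm.trans π.1) = (fun p => (col p, f₀ p))
      then ⟨π₁.symm.trans π.1, h⟩ else ⟨1, rfl⟩) (fun _ _ => Finset.mem_coe.mpr (Finset.mem_univ _)) ?_
  intro π hπ ρ hρ h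
  simp only [hmem π hπ, hmem ρ hρ, dif_pos, Subtype.mk.injEq] at h
  ext1
  have := congrArg (fun x => π₁.trans x) h
  simpa [← Equiv.trans_assoc] using this

lemma exists_equiv_of_sign {X Y : Type*} [LinearOrder X] [LinearOrder Y] [Finite X] [Finite Y]
    (h : Nat.card X = Nat.card Y) (s : SignType) :
    ∃ e : X ≃ Y, (s = 1 → StrictMono e) ∧ (s = -1 → StrictAnti e) := by
  have := Fintype.ofFinite X
  have := Fintype.ofFinite Y
  let e₁ := Fintype.orderIsoFinOfCardEq X (k := Nat.card X) Nat.card_eq_fintype_card.symm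
  let e₂ := Fintype.orderIsoFinOfCardEq Y (k := Nat.card X) (h ▸ Nat.card_eq_fintype_card.symm)
  by_cases hs : s = 1
  · refine ⟨(e₁.symm.trans e₂).toEquiv, fun _ => (e₁.symm.trans e₂).strictMono, ?_⟩
    rintro rfl
    exact absurd hs (by decide)
  · refine ⟨e₁.symm.toEquiv.trans (Fin.revPerm.trans e₂.toEquiv), fun h => absurd h hs, fun _ => ?_⟩
    intro x y hxy
    exact e₂.strictMono (Fin.rev_lt_rev.mpr (e₁.symm.strictMono hxy))

/-- Existence counterpart of `Compatible.eq_of_labels_eq`: any two label words with matching cell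
counts are realized, by gluing in each cell the bijection of the required direction. -/
lemma exists_compatible {t u k : ℕ} {M : CellMatrix t u} {a : Fin t × Fin u → ℕ}
    (ha : ∀ i j, M i j = 0 → a (i, j) = 0) {col f' : Fin k → _} {row g' : Fin k → _}
    (hf : ∀ c, Nat.card {p // (col p, f' p) = c} = a c)
    (hg : ∀ c, Nat.card {v // (row v, g' v) = c} = a c.swap) :
    ∃ σ : Equiv.Perm (Fin k), Compatible M col row σ ∧ row ∘ σ = f' ∧ col ∘ σ.symm = g' := by
  have hc : ∀ c : Fin t × Fin u,
      Nat.card {p // (col p, f' p) = c} = Nat.card {v // (g' v, row v) = c} := by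
    intro c
    rw [hf, ← Prod.swap_swap c, ← hg, Prod.swap_swap]
    exact Nat.card_congr (Equiv.subtypeEquivRight fun v => by
      rw [Prod.ext_iff, Prod.ext_iff]; exact and_comm)
  choose e he₁ he₂ using fun c => exists_equiv_of_sign (hc c) (M c.1 c.2)
  let σ : Equiv.Perm (Fin k) := Equiv.ofFiberEquiv e
  have hσ : ∀ p, (g' (σ p), row (σ p)) = (col p, f' p) := fun p =>
    Equiv.ofFiberEquiv_map (g := fun v => (g' v, row v)) e p
  have hσe : ∀ c (p : {p // (col p, f' p) = c}), σ p = e c p := by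
    rintro _ ⟨p, rfl⟩
    rfl
  have hrow : ∀ p, row (σ p) = f' p := fun p => (Prod.ext_iff.mp (hσ p)).2
  have hcol : ∀ p, g' (σ p) = col p := fun p => (Prod.ext_iff.mp (hσ p)).1
  have hcell : ∀ {i j p}, p ∈ {b | col b = i ∧ row (σ b) = j} → (col p, f' p) = (i, j) := by
    rintro i j p ⟨h1, h2⟩
    rw [← hrow, h1, h2]
  refine ⟨σ, ⟨fun i j h p hp q hq hpq => ?_, fun i j h p hp q hq hpq => ?_, fun p h => ?_⟩,
    funext hrow, funext fun v => ?_⟩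
  · rw [hσe (i, j) ⟨p, hcell hp⟩, hσe (i, j) ⟨q, hcell hq⟩]
    exact he₁ (i, j) h hpq
  · rw [hσe (i, j) ⟨p, hcell hp⟩, hσe (i, j) ⟨q, hcell hq⟩]
    exact he₂ (i, j) h hpq
  · rw [hrow] at h
    have h1 := hf (col p, f' p)
    rw [ha _ _ h] at h1
    have : Nonempty {q // (col q, f' q) = (col p, f' p)} := ⟨⟨p, rfl⟩⟩
    exact Nat.card_pos.ne' h1
  · rw [Function.comp_apply, ← hcol, Equiv.apply_symm_apply]

lemma prod_factorial_le_ncard_grid {t u k : ℕ} {M : CellMatrix t u} {a : Fin t × Fin u → ℕ}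
    (ha : ∀ i j, M i j = 0 → a (i, j) = 0) (hk : ∑ c, a c = k) :
    (∏ i, (∑ j, a (i, j))!) * ∏ j, (∑ i, a (i, j))! ≤
      (Grid M k).ncard * (∏ c, (a c)!) ^ 2 := by
  classical
  obtain ⟨h, hm, hc⟩ := exists_labels Prod.fst a hk
  obtain ⟨h', hm', hc'⟩ := exists_labels Prod.fst (fun c : Fin u × Fin t => a c.swap)
    (k := k) (by rw [← hk]; exact Fintype.sum_equiv (Equiv.prodComm _ _) _ _ fun _ => rfl)
  set col := Prod.fst ∘ h
  set row := Prod.fst ∘ h'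
  let A := {f : Fin k → Fin u // ∀ c, Nat.card {p // (col p, f p) = c} = a c}
  let B := {g : Fin k → Fin t // ∀ c, Nat.card {v // (row v, g v) = c} = a c.swap}
  have hA : ∏ i, (∑ j, a (i, j))! ≤ Nat.card A * ∏ c, (a c)! :=
    prod_factorial_le_card_labels col (Prod.snd ∘ h) a hc
  have hB : ∏ j, (∑ i, a (i, j))! ≤ Nat.card B * ∏ c, (a c)! := by
    have := prod_factorial_le_card_labels row (Prod.snd ∘ h') (fun c => a c.swap) hc'
    have e : ∏ c : Fin u × Fin t, (a c.swap)! = ∏ c, (a c)! :=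
      Fintype.prod_equiv (Equiv.prodComm _ _) _ _ fun _ => rfl
    rwa [e] at this
  choose σ hσ hrow hcol using fun p : A × B => exists_compatible ha p.1.2 p.2.2
  have hinj : Function.Injective fun p => (⟨σ p, mem_grid_iff.mpr ⟨col, row, hm, hm', hσ p⟩⟩ :
      Grid M k) := by
    intro p q hpq
    have hpq : σ p = σ q := congrArg Subtype.val hpq
    refine Prod.ext (Subtype.ext ?_) (Subtype.ext ?_)
    · rw [← hrow p, hpq, hrow q]
    · rw [← hcol p, hpq, hcol q]
  have hAB : Nat.card A * Nat.card B ≤ (Grid M k).ncard := by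
    rw [← Nat.card_prod, ← Nat.card_coe_set_eq]
    exact Nat.card_le_card_of_injective _ hinj
  calc _ ≤ (Nat.card A * ∏ c, (a c)!) * (Nat.card B * ∏ c, (a c)!) := Nat.mul_le_mul hA hB
    _ = Nat.card A * Nat.card B * (∏ c, (a c)!) ^ 2 := by ring
    _ ≤ _ := Nat.mul_le_mul_right _ hAB

/-! ### Stirling estimates and the entropy limit -/

lemma mul_log_sub_le_log_factorial (n : ℕ) : n * Real.log n - n ≤ Real.log (n ! : ℝ) := by
  rcases Nat.eq_zero_or_pos n with rfl | hn
  · simp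
  have h := Real.pow_div_factorial_le_exp (x := n) (Nat.cast_nonneg n) n
  have h0 : (0 : ℝ) < n := Nat.cast_pos.mpr hn
  have h1 : (0 : ℝ) < (n ! : ℝ) := Nat.cast_pos.mpr (Nat.factorial_pos n)
  have := Real.log_le_log (by positivity) h
  rw [Real.log_exp, Real.log_div (by positivity) h1.ne', Real.log_pow] at this
  linarith

lemma log_factorial_le {n : ℕ} (hn : 1 ≤ n) :
    Real.log (n ! : ℝ) ≤ n * Real.log n - n + Real.log n + 1 := by
  induction n, hn using Nat.le_induction with
  | base => simp
  | succ n hn ih =>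
    have h0 : (0 : ℝ) < n := Nat.cast_pos.mpr hn
    have h1 : (0 : ℝ) < (n ! : ℝ) := Nat.cast_pos.mpr (Nat.factorial_pos n)
    have h2 := Real.log_le_sub_one_of_pos (x := n / (n + 1)) (by positivity)
    rw [Real.log_div h0.ne' (by positivity)] at h2
    have h3 : (n : ℝ) / (n + 1) - 1 = - (1 / (n + 1)) := by field_simp; ring
    have h4 : ((n : ℝ) + 1) * (1 / (n + 1)) = 1 := by field_simp
    rw [h3] at h2
    have h5 := mul_le_mul_of_nonneg_left h2 (by positivity : (0 : ℝ) ≤ n + 1)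
    rw [Nat.factorial_succ]
    push_cast
    rw [Real.log_mul (by positivity) h1.ne']
    nlinarith

/-- Subtracting `n k * log k` turns Stirling's main term into a function of the ratio `n k / k`;
continuity of `x * log x` at 0 covers `p = 0`. -/
lemma tendsto_log_factorial_div {n : ℕ → ℕ} (hn : ∀ k, n k ≤ k) {p : ℝ}
    (h : Tendsto (fun k => (n k : ℝ) / k) atTop (𝓝 p)) :
    Tendsto (fun k => (Real.log ((n k)! : ℝ) - n k * Real.log k) / k) atTop
      (𝓝 (p * Real.log p - p)) := by
  have h1 : Tendsto (fun k => (n k : ℝ) / k * Real.log ((n k : ℝ) / k) - (n k : ℝ) / k) atTop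
      (𝓝 (p * Real.log p - p)) :=
    ((Real.continuous_mul_log.tendsto p).comp h).sub h
  have hlog : Tendsto (fun k : ℕ => (Real.log k + 1) / (k : ℝ)) atTop (𝓝 0) := by
    have h2 : Tendsto (fun x : ℝ => (Real.log x + 1) / x) atTop (𝓝 0) := by
      have := (Real.isLittleO_log_id_atTop.tendsto_div_nhds_zero).add tendsto_inv_atTop_zero
      simp only [add_zero] at this
      refine this.congr fun x => ?_
      simp only [id]
      ring
    exact h2.comp tendsto_natCast_atTop_atTop
  have h2 : Tendsto (fun k => (Real.log ((n k)! : ℝ) - (n k * Real.log (n k) - n k)) / k) atTop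
      (𝓝 0) := by
    refine tendsto_of_tendsto_of_tendsto_of_le_of_le' tendsto_const_nhds hlog ?_ ?_
    · exact Eventually.of_forall fun k =>
        div_nonneg (sub_nonneg.mpr (mul_log_sub_le_log_factorial _)) (Nat.cast_nonneg k)
    · filter_upwards [eventually_ge_atTop 1] with k hk
      have hk' : (1 : ℝ) ≤ k := Nat.one_le_cast.mpr hk
      gcongr
      rcases Nat.eq_zero_or_pos (n k) with h0 | h0
      · rw [h0]
        have := Real.log_nonneg hk'
        simp
        linarith
      · have h3 := log_factorial_le h0
        have h4 : Real.log (n k) ≤ Real.log k :=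
          Real.log_le_log (Nat.cast_pos.mpr h0) (Nat.cast_le.mpr (hn k))
        linarith
  have h3 := h1.add h2
  rw [add_zero] at h3
  refine h3.congr' ?_
  filter_upwards [eventually_ge_atTop 1] with k hk
  have hk' : (0 : ℝ) < k := Nat.cast_pos.mpr hk
  rcases Nat.eq_zero_or_pos (n k) with h0 | h0
  · simp [h0]
  · have h0' : (0 : ℝ) < n k := Nat.cast_pos.mpr h0
    rw [Real.log_div h0'.ne' hk'.ne']
    field_simp
    ring

/-- A probability vector can be approximated by integer vectors of sum `k` with the same support. -/
lemma exists_integer_approx {ι : Type*} [Fintype ι] (p : ι → ℝ) (hp : ∀ c, 0 ≤ p c)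
    (hs : ∑ c, p c = 1) :
    ∃ a : ℕ → ι → ℕ, (∀ k, ∑ c, a k c = k) ∧ (∀ k c, p c = 0 → a k c = 0) ∧
      ∀ c, Tendsto (fun k => (a k c : ℝ) / k) atTop (𝓝 (p c)) := by
  classical
  -- All other coordinates are rounded down, and `c₀` absorbs the deficit; having `p c₀ ≠ 0` keeps
  -- the support condition.
  obtain ⟨c₀, hc₀⟩ : ∃ c, p c ≠ 0 := by
    by_contra! h
    simp [h] at hs
  let s := Finset.univ.erase c₀
  let R : ℕ → ℕ := fun k => ∑ c ∈ s, ⌊p c * k⌋₊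
  have hsum : p c₀ + ∑ c ∈ s, p c = 1 := by
    rw [← hs]; exact Finset.add_sum_erase _ _ (Finset.mem_univ _)
  have hR : ∀ k, R k ≤ k := by
    intro k
    have : (R k : ℝ) ≤ k := by
      calc (R k : ℝ) = ∑ c ∈ s, (⌊p c * k⌋₊ : ℝ) := by simp [R]
        _ ≤ ∑ c ∈ s, p c * k := Finset.sum_le_sum fun c _ =>
            Nat.floor_le (mul_nonneg (hp c) (Nat.cast_nonneg k))
        _ = (∑ c ∈ s, p c) * k := (Finset.sum_mul ..).symm
        _ ≤ 1 * k := by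
            gcongr
            linarith [hp c₀]
        _ = k := one_mul _
    exact_mod_cast this
  have hfloor : ∀ c, Tendsto (fun k : ℕ => (⌊p c * k⌋₊ : ℝ) / k) atTop (𝓝 (p c)) := fun c =>
    (tendsto_nat_floor_mul_div_atTop (hp c)).comp tendsto_natCast_atTop_atTop
  refine ⟨fun k c => if c = c₀ then k - R k else ⌊p c * k⌋₊, fun k => ?_, fun k c hc => ?_,
    fun c => ?_⟩
  · dsimp only
    rw [← Finset.add_sum_erase _ _ (Finset.mem_univ c₀), if_pos rfl]
    have : ∑ c ∈ s, (if c = c₀ then k - R k else ⌊p c * k⌋₊) = R k :=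
      Finset.sum_congr rfl fun c hc => if_neg (Finset.ne_of_mem_erase hc)
    rw [this]
    have := hR k
    omega
  · have : c ≠ c₀ := fun h => hc₀ (h ▸ hc)
    simp [this, hc]
  · by_cases h : c = c₀
    · subst h
      simp only [if_pos]
      have h1 : Tendsto (fun k : ℕ => 1 - ∑ c ∈ s, (⌊p c * k⌋₊ : ℝ) / k) atTop (𝓝 (p c)) := by
        rw [show p c = 1 - ∑ c ∈ s, p c by linarith]
        exact tendsto_const_nhds.sub (tendsto_finsetSum _ fun c _ => hfloor c)
      refine h1.congr' ?_
      filter_upwards [eventually_ge_atTop 1] with k hk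
      have hk' : (k : ℝ) ≠ 0 := by positivity
      rw [Nat.cast_sub (hR k), sub_div, div_self hk', ← Finset.sum_div]
      simp [R]
    · simp only [if_neg h]
      exact hfloor c

lemma exists_lower_bound_of_weights {t u : ℕ} {M : CellMatrix t u} {p : Fin t × Fin u → ℝ}
    (hp : ∀ c, 0 ≤ p c) (hs : ∑ c, p c = 1) (hM : ∀ i j, M i j = 0 → p (i, j) = 0) :
    ∃ L : ℕ → ℝ, (∀ k, 0 < L k) ∧ (∀ k, L k ≤ (Grid M k).ncard) ∧
      Tendsto (fun k => Real.log (L k) / k) atTop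
        (𝓝 (∑ i, (∑ j, p (i, j)) * Real.log (∑ j, p (i, j)) +
          ∑ j, (∑ i, p (i, j)) * Real.log (∑ i, p (i, j)) - 2 * ∑ c, p c * Real.log (p c))) := by
  obtain ⟨a, ha, ha0, hlim⟩ := exists_integer_approx p hp hs
  have hpos : ∀ n : ℕ, (0 : ℝ) < (n ! : ℝ) := fun n => Nat.cast_pos.mpr (Nat.factorial_pos n)
  have hprod : ∀ k, (0 : ℝ) < ∏ c, ((a k c)! : ℝ) := fun k => Finset.prod_pos fun _ _ => hpos _
  have hrow : ∀ k, ∑ i, ∑ j, a k (i, j) = k := fun k => by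
    rw [← Fintype.sum_prod_type, ha]
  have hcol : ∀ k, ∑ j, ∑ i, a k (i, j) = k := fun k => by
    rw [← Fintype.sum_prod_type_right, ha]
  have prow : ∑ i, ∑ j, p (i, j) = 1 := by rw [← Fintype.sum_prod_type, hs]
  have pcol : ∑ j, ∑ i, p (i, j) = 1 := by rw [← Fintype.sum_prod_type_right, hs]
  refine ⟨fun k => ((∏ i, ((∑ j, a k (i, j))! : ℝ)) * ∏ j, ((∑ i, a k (i, j))! : ℝ)) /
    (∏ c, ((a k c)! : ℝ)) ^ 2, fun k => ?_, fun k => ?_, ?_⟩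
  · exact div_pos (mul_pos (Finset.prod_pos fun _ _ => hpos _) (Finset.prod_pos fun _ _ => hpos _))
      (pow_pos (hprod k) 2)
  · rw [div_le_iff₀ (pow_pos (hprod k) 2)]
    exact_mod_cast prod_factorial_le_ncard_grid (fun i j h => ha0 k _ (hM i j h)) (ha k)
  · have e1 : ∀ i, Tendsto (fun k => (Real.log ((∑ j, a k (i, j))! : ℝ) -
        ((∑ j, a k (i, j) : ℕ) : ℝ) * Real.log k) / k) atTop
        (𝓝 ((∑ j, p (i, j)) * Real.log (∑ j, p (i, j)) - ∑ j, p (i, j))) := by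
      intro i
      refine tendsto_log_factorial_div (fun k => ?_) ?_
      · conv_rhs => rw [← hrow k]
        exact Finset.single_le_sum (f := fun i => ∑ j, a k (i, j)) (fun _ _ => Nat.zero_le _)
          (Finset.mem_univ i)
      · refine (tendsto_finsetSum _ fun j _ => hlim (i, j)).congr fun k => ?_
        rw [← Finset.sum_div]
        push_cast
        rfl
    have e2 : ∀ j, Tendsto (fun k => (Real.log ((∑ i, a k (i, j))! : ℝ) -
        ((∑ i, a k (i, j) : ℕ) : ℝ) * Real.log k) / k) atTop
        (𝓝 ((∑ i, p (i, j)) * Real.log (∑ i, p (i, j)) - ∑ i, p (i, j))) := by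
      intro j
      refine tendsto_log_factorial_div (fun k => ?_) ?_
      · conv_rhs => rw [← hcol k]
        exact Finset.single_le_sum (f := fun j => ∑ i, a k (i, j)) (fun _ _ => Nat.zero_le _)
          (Finset.mem_univ j)
      · refine (tendsto_finsetSum _ fun i _ => hlim (i, j)).congr fun k => ?_
        rw [← Finset.sum_div]
        push_cast
        rfl
    have e3 : ∀ c, Tendsto (fun k => (Real.log ((a k c)! : ℝ) - (a k c : ℝ) * Real.log k) / k)
        atTop (𝓝 (p c * Real.log (p c) - p c)) := by
      intro c
      refine tendsto_log_factorial_div (fun k => ?_) (hlim c)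
      conv_rhs => rw [← ha k]
      exact Finset.single_le_sum (fun _ _ => Nat.zero_le _) (Finset.mem_univ c)
    have e := ((tendsto_finsetSum Finset.univ fun i _ => e1 i).add
      (tendsto_finsetSum Finset.univ fun j _ => e2 j)).sub
      ((tendsto_finsetSum Finset.univ fun c _ => e3 c).const_mul 2)
    -- The linear terms cancel as `-1 - 1 + 2`; likewise the `log k` terms below cancel because each
    -- family of counts sums to `k`.
    simp only [Finset.sum_sub_distrib, prow, pcol, hs] at e
    convert e.congr fun k => ?_ using 2
    · ring
    · have h1 : ∑ i, ((∑ j, a k (i, j) : ℕ) : ℝ) = k := by exact_mod_cast hrow k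
      have h2 : ∑ j, ((∑ i, a k (i, j) : ℕ) : ℝ) = k := by exact_mod_cast hcol k
      have h3 : ∑ c, (a k c : ℝ) = k := by exact_mod_cast ha k
      rw [← Finset.sum_div, ← Finset.sum_div, ← Finset.sum_div, Finset.sum_sub_distrib,
        Finset.sum_sub_distrib, Finset.sum_sub_distrib, ← Finset.sum_mul, ← Finset.sum_mul,
        ← Finset.sum_mul, h1, h2, h3, Real.log_div, Real.log_mul, Real.log_pow, Real.log_prod,
        Real.log_prod, Real.log_prod]
      · push_cast
        ring
      · exact fun _ _ => (hpos _).ne'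
      · exact fun _ _ => (hpos _).ne'
      · exact fun _ _ => (hpos _).ne'
      · exact (Finset.prod_pos fun _ _ => hpos _).ne'
      · exact (Finset.prod_pos fun _ _ => hpos _).ne'
      · exact (mul_pos (Finset.prod_pos fun _ _ => hpos _) (Finset.prod_pos fun _ _ => hpos _)).ne'
      · exact (pow_pos (hprod k) 2).ne'

/-! ### Growth rate from a positive eigenvector -/

lemma tendsto_poly_rpow_inv (D : ℕ) :
    Tendsto (fun k : ℕ => (((k : ℝ) + 1) ^ D) ^ (1 / (k : ℝ))) atTop (𝓝 1) := by
  have h := (tendsto_rpow_div_mul_add (D : ℝ) 1 (-1) (by norm_num)).comp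
    (tendsto_atTop_add_const_right atTop (1 : ℝ) (tendsto_natCast_atTop_atTop (R := ℝ)))
  refine h.congr fun k => ?_
  simp only [Function.comp_apply]
  rw [← Real.rpow_natCast, ← Real.rpow_mul (by positivity)]
  congr 1
  rw [show (1 : ℝ) * (k + 1) + -1 = k by ring]
  ring

theorem hasGrowthRate_sq_of_eigenvector {t u : ℕ} (M : CellMatrix t u) {x : Fin t → ℝ}
    {y : Fin u → ℝ} (hx : ∀ i, 0 < x i) (hy : ∀ j, 0 < y j) {l : ℝ}
    (h1 : ∀ i, ∑ j, (if M i j = 0 then 0 else y j) = l * x i)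
    (h2 : ∀ j, ∑ i, (if M i j = 0 then 0 else x i) = l * y j) (hne : Nonempty (Fin t ⊕ Fin u)) :
    HasGrowthRate (Grid M) (l ^ 2) := by
  by_cases hM : ∀ i j, M i j = 0
  -- With no non-zero cell, only the empty permutation can be gridded, and the eigenvector equations
  -- force `l = 0`.
  · have hl : l = 0 := by
      obtain ⟨i | j⟩ := hne
      · have := h1 i
        simp only [hM, if_pos, Finset.sum_const_zero] at this
        exact (mul_eq_zero.mp this.symm).resolve_right (hx i).ne'
      · have := h2 j
        simp only [hM, if_pos, Finset.sum_const_zero] at this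
        exact (mul_eq_zero.mp this.symm).resolve_right (hy j).ne'
    refine tendsto_const_nhds.congr' ?_
    filter_upwards [eventually_ge_atTop 1] with k hk
    have : Grid M k = ∅ := by
      rw [Set.eq_empty_iff_forall_notMem]
      intro σ hσ
      obtain ⟨col, row, -, -, h⟩ := mem_grid_iff.mp hσ
      exact h.ne_zero ⟨0, hk⟩ (hM _ _)
    have hk' : (1 / (k : ℝ)) ≠ 0 := by positivity
    rw [this, Set.ncard_empty, Nat.cast_zero, Real.zero_rpow hk', hl]
    norm_num
  push Not at hM
  obtain ⟨i₀, j₀, h₀⟩ := hM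
  have hl : 0 < l := by
    have h3 : 0 < l * x i₀ := by
      rw [← h1]
      refine Finset.sum_pos' (fun j _ => ?_) ⟨j₀, Finset.mem_univ _, ?_⟩
      · split_ifs
        exacts [le_rfl, (hy j).le]
      · rw [if_neg h₀]
        exact hy j₀
    exact pos_of_mul_pos_left h3 (hx i₀).le
  have hlogl : Real.exp (2 * Real.log l) = l ^ 2 := by
    rw [← Real.exp_log (pow_pos hl 2), Real.log_pow]
    norm_num
  have upper : ∀ k : ℕ, 1 ≤ k → ((Grid M k).ncard : ℝ) ^ (1 / (k : ℝ)) ≤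
      (((k : ℝ) + 1) ^ (t + 1 + (u + 1))) ^ (1 / (k : ℝ)) * l ^ 2 := by
    intro k hk
    -- The eigenvector equations make both kernels stochastic, and on every non-zero cell their
    -- product is exactly `1 / l ^ 2`.
    have h := ncard_grid_mul_pow_le (M := M) (fun i j => if M i j = 0 then 0 else y j / (l * x i))
      (fun j i => if M i j = 0 then 0 else x i / (l * y j))
      (fun i j => by
        split_ifs
        exacts [le_rfl, (div_pos (hy j) (mul_pos hl (hx i))).le])
      (fun j i => by
        split_ifs
        exacts [le_rfl, (div_pos (hx i) (mul_pos hl (hy j))).le])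
      (fun i => by
        have : ∀ j, (if M i j = 0 then 0 else y j / (l * x i)) =
          (if M i j = 0 then 0 else y j) / (l * x i) := fun j => by split_ifs <;> simp
        simp only [this]
        rw [← Finset.sum_div, h1, div_self (mul_pos hl (hx i)).ne'])
      (fun j => by
        have : ∀ i, (if M i j = 0 then 0 else x i / (l * y j)) =
          (if M i j = 0 then 0 else x i) / (l * y j) := fun j => by split_ifs <;> simp
        simp only [this]
        rw [← Finset.sum_div, h2, div_self (mul_pos hl (hy j)).ne'])
      (w := (l ^ 2)⁻¹) (by positivity)
      (fun i j hij => by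
        have := hx i
        have := hy j
        simp only [if_neg hij]
        apply le_of_eq
        field_simp) k
    have h' : ((Grid M k).ncard : ℝ) ≤ ((k : ℝ) + 1) ^ (t + 1 + (u + 1)) * (l ^ 2) ^ k := by
      rwa [inv_pow, ← div_eq_mul_inv, div_le_iff₀ (by positivity)] at h
    calc ((Grid M k).ncard : ℝ) ^ (1 / (k : ℝ))
        ≤ (((k : ℝ) + 1) ^ (t + 1 + (u + 1)) * (l ^ 2) ^ k) ^ (1 / (k : ℝ)) :=
          Real.rpow_le_rpow (Nat.cast_nonneg _) h' (by positivity)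
      _ = _ := by
          rw [Real.mul_rpow (by positivity) (by positivity), one_div,
            Real.pow_rpow_inv_natCast (by positivity) (by omega)]
  set N := ∑ i, x i ^ 2 with hN
  have hNpos : 0 < N := Finset.sum_pos' (fun i _ => sq_nonneg _)
    ⟨i₀, Finset.mem_univ _, pow_pos (hx i₀) 2⟩
  -- The matching cell distribution: its marginals are `x i ^ 2 / N` and `y j ^ 2 / N`.
  let p : Fin t × Fin u → ℝ := fun c => if M c.1 c.2 = 0 then 0 else x c.1 * y c.2 / (l * N)
  have hp : ∀ c, 0 ≤ p c := by
    intro c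
    dsimp only [p]
    split_ifs
    exacts [le_rfl, (div_pos (mul_pos (hx _) (hy _)) (mul_pos hl hNpos)).le]
  have hrow : ∀ i, ∑ j, p (i, j) = x i ^ 2 / N := by
    intro i
    have : ∀ j, p (i, j) = (if M i j = 0 then 0 else y j) * (x i / (l * N)) := by
      intro j
      dsimp only [p]
      split_ifs
      · simp
      · ring
    simp only [this]
    rw [← Finset.sum_mul, h1]
    field_simp
  have hcol : ∀ j, ∑ i, p (i, j) = y j ^ 2 / N := by
    intro j
    have : ∀ i, p (i, j) = (if M i j = 0 then 0 else x i) * (y j / (l * N)) := by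
      intro i
      dsimp only [p]
      split_ifs
      · simp
      · ring
    simp only [this]
    rw [← Finset.sum_mul, h2]
    field_simp
  have hsum : ∑ i, ∑ j, p (i, j) = 1 := by
    simp only [hrow]
    rw [← Finset.sum_div, ← hN, div_self hNpos.ne']
  have hs : ∑ c, p c = 1 := by rw [Fintype.sum_prod_type, hsum]
  have hsum' : ∑ j, ∑ i, p (i, j) = 1 := by rw [Finset.sum_comm, hsum]
  obtain ⟨L, hL0, hLle, hL⟩ := exists_lower_bound_of_weights hp hs (M := M) fun i j h => if_pos h
  -- On the support `log p` splits as `log x + log y - log l - log N`, so the `x`, `y` and `N` terms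
  -- cancel against the marginals.
  have hval : ∑ i, (∑ j, p (i, j)) * Real.log (∑ j, p (i, j)) +
      ∑ j, (∑ i, p (i, j)) * Real.log (∑ i, p (i, j)) - 2 * ∑ c, p c * Real.log (p c) =
        2 * Real.log l := by
    have e1 : ∀ i, (∑ j, p (i, j)) * Real.log (∑ j, p (i, j)) =
        2 * ((∑ j, p (i, j)) * Real.log (x i)) - (∑ j, p (i, j)) * Real.log N := by
      intro i
      have : Real.log (∑ j, p (i, j)) = 2 * Real.log (x i) - Real.log N := by
        rw [hrow, Real.log_div (pow_pos (hx i) 2).ne' hNpos.ne', Real.log_pow]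
        norm_num
      rw [this]
      ring
    have e2 : ∀ j, (∑ i, p (i, j)) * Real.log (∑ i, p (i, j)) =
        2 * ((∑ i, p (i, j)) * Real.log (y j)) - (∑ i, p (i, j)) * Real.log N := by
      intro j
      have : Real.log (∑ i, p (i, j)) = 2 * Real.log (y j) - Real.log N := by
        rw [hcol, Real.log_div (pow_pos (hy j) 2).ne' hNpos.ne', Real.log_pow]
        norm_num
      rw [this]
      ring
    have e3 : ∀ i j, p (i, j) * Real.log (p (i, j)) = p (i, j) * Real.log (x i) +
        p (i, j) * Real.log (y j) - p (i, j) * (Real.log l + Real.log N) := by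
      intro i j
      by_cases h : M i j = 0
      · simp [p, h]
      · have : Real.log (p (i, j)) =
            Real.log (x i) + Real.log (y j) - (Real.log l + Real.log N) := by
          simp only [p, if_neg h]
          rw [Real.log_div (mul_pos (hx i) (hy j)).ne' (mul_pos hl hNpos).ne',
            Real.log_mul (hx i).ne' (hy j).ne', Real.log_mul hl.ne' hNpos.ne']
        rw [this]
        ring
    have e4 : ∑ i, ∑ j, p (i, j) * Real.log (y j) = ∑ j, (∑ i, p (i, j)) * Real.log (y j) := by
      rw [Finset.sum_comm]
      simp only [Finset.sum_mul]
    rw [Fintype.sum_prod_type]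
    simp only [e1, e2, e3, Finset.sum_sub_distrib, Finset.sum_add_distrib]
    rw [e4]
    simp only [← Finset.mul_sum, ← Finset.sum_mul, hsum, hsum']
    ring
  rw [hval] at hL
  have lower : ∀ k, Real.exp (Real.log (L k) / k) ≤ ((Grid M k).ncard : ℝ) ^ (1 / (k : ℝ)) := by
    intro k
    rw [div_eq_mul_one_div, ← Real.rpow_def_of_pos (hL0 k)]
    exact Real.rpow_le_rpow (hL0 k).le (hLle k) (by positivity)
  refine tendsto_of_tendsto_of_tendsto_of_le_of_le' (g := fun k => Real.exp (Real.log (L k) / k))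
    (h := fun k => (((k : ℝ) + 1) ^ (t + 1 + (u + 1))) ^ (1 / (k : ℝ)) * l ^ 2) ?_ ?_
    (Eventually.of_forall lower) ?_
  · rw [← hlogl]
    exact (Real.continuous_exp.tendsto _).comp hL
  · simpa using (tendsto_poly_rpow_inv (t + 1 + (u + 1))).mul_const (l ^ 2)
  · filter_upwards [eventually_ge_atTop 1] with k hk using upper k hk

/-! ### Perron–Frobenius for finite graphs -/

open Classical in
/-- The product of the adjacency matrix of `G` with the vector `z`. -/
noncomputable def adjSum {V : Type*} [Fintype V] (G : SimpleGraph V) (z : V → ℝ) (v : V) : ℝ :=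
  ∑ w, if G.Adj v w then z w else 0

lemma adjSum_nonneg {V : Type*} [Fintype V] (G : SimpleGraph V) {z : V → ℝ} (hz : ∀ v, 0 ≤ z v)
    (v : V) : 0 ≤ adjSum G z v :=
  Finset.sum_nonneg fun w _ => by
    split_ifs
    exacts [hz w, le_rfl]

lemma sum_adjSum_mul_comm {V : Type*} [Fintype V] (G : SimpleGraph V) (y z : V → ℝ) :
    ∑ v, adjSum G z v * y v = ∑ v, adjSum G y v * z v := by
  simp only [adjSum, Finset.sum_mul]
  rw [Finset.sum_comm]
  refine Finset.sum_congr rfl fun v _ => Finset.sum_congr rfl fun w _ => ?_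
  by_cases h : G.Adj v w
  · simp [h, h.symm, mul_comm]
  · simp [h, show ¬ G.Adj w v from fun h' => h h'.symm]

/-- A nonnegative eigenvector of the adjacency matrix, obtained by maximizing the quadratic form. -/
lemma exists_nonneg_eigenvector {V : Type*} [Fintype V] [Nonempty V] (G : SimpleGraph V) :
    ∃ (l : ℝ) (z : V → ℝ), (∀ v, 0 ≤ z v) ∧ (∃ v, z v ≠ 0) ∧ ∀ v, adjSum G z v = l * z v := by
  classical
  let Q : (V → ℝ) → ℝ := fun z => ∑ v, adjSum G z v * z v
  have hQc : Continuous Q := by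
    refine continuous_finsetSum _ fun v _ => Continuous.mul ?_ (continuous_apply v)
    refine continuous_finsetSum _ fun w _ => ?_
    split_ifs
    exacts [continuous_apply w, continuous_const]
  let K : Set (V → ℝ) := {z | (∀ v, 0 ≤ z v) ∧ ∑ v, z v ^ 2 = 1}
  have hK : IsCompact K := by
    refine (isCompact_Icc (a := (0 : V → ℝ)) (b := 1)).of_isClosed_subset ?_ ?_
    · refine IsClosed.and ?_ ?_
      · simp only [Set.ofPred_forall]
        exact isClosed_iInter fun v => isClosed_le continuous_const (continuous_apply v)
      · exact isClosed_eq (continuous_finsetSum _ fun v _ => (continuous_apply v).pow 2)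
          continuous_const
    · rintro z ⟨h0, h1⟩
      refine ⟨h0, fun v => ?_⟩
      have : z v ^ 2 ≤ 1 := h1 ▸ Finset.single_le_sum (f := fun v => z v ^ 2)
        (fun _ _ => sq_nonneg _) (Finset.mem_univ v)
      exact (sq_le_one_iff₀ (h0 v)).mp this
  obtain ⟨v₀⟩ := ‹Nonempty V›
  obtain ⟨z, ⟨hz0, hz1⟩, hmax⟩ := hK.exists_isMaxOn
    ⟨Pi.single v₀ 1, fun v => by by_cases h : v = v₀ <;> simp [h],
      by simp [Pi.single_apply]⟩ hQc.continuousOn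
  -- Taking absolute values does not decrease `Q`, and `Q` is homogeneous of degree 2, so the
  -- maximum over `K` bounds `Q` everywhere.
  have hQ : ∀ y : V → ℝ, Q y ≤ Q z * ∑ v, y v ^ 2 := by
    intro y
    have habs : Q y ≤ Q fun v => |y v| := by
      refine Finset.sum_le_sum fun v _ => ?_
      simp only [adjSum, Finset.sum_mul]
      refine Finset.sum_le_sum fun w _ => ?_
      split_ifs
      · rw [← abs_mul]
        exact le_abs_self _
      · simp
    refine habs.trans ?_
    rcases (Finset.sum_nonneg fun v _ => sq_nonneg (y v) :
      0 ≤ ∑ v, y v ^ 2).eq_or_lt with h | h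
    · have : ∀ v, y v = 0 := fun v => by
        simpa using (Finset.sum_eq_zero_iff_of_nonneg fun v _ => sq_nonneg (y v)).mp h.symm v
          (Finset.mem_univ v)
      simp [this, Q]
    · set S := ∑ v, y v ^ 2 with hS
      set c := Real.sqrt S with hc
      have hc2 : c ^ 2 = S := Real.sq_sqrt h.le
      have hc0 : 0 < c := Real.sqrt_pos.mpr h
      have hmem : (fun v => |y v| / c) ∈ K := by
        refine ⟨fun v => by positivity, ?_⟩
        simp only [div_pow, sq_abs]
        rw [← Finset.sum_div, hc2, ← hS, div_self h.ne']
      have h1 : Q (fun v => |y v| / c) ≤ Q z := hmax hmem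
      have h2 : Q (fun v => |y v| / c) = Q (fun v => |y v|) / S := by
        simp only [Q, adjSum]
        rw [Finset.sum_div]
        refine Finset.sum_congr rfl fun v _ => ?_
        rw [← hc2, Finset.sum_mul, Finset.sum_mul, Finset.sum_div]
        refine Finset.sum_congr rfl fun w _ => ?_
        split_ifs
        · field_simp
        · simp
      rwa [h2, div_le_iff₀ h] at h1
  refine ⟨Q z, z, hz0, ?_, fun v => ?_⟩
  · by_contra! h
    simp [h] at hz1
  -- Perturbing `z` at one coordinate gives a nonnegative quadratic in `ε` without constant term;
  -- its linear coefficient, the eigenvector defect at `v`, must vanish.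
  · have key : ∀ ε : ℝ, 0 ≤ (Q z - Q (Pi.single v 1)) * (ε * ε) +
        (2 * (Q z * z v - adjSum G z v)) * ε + 0 := by
      intro ε
      have h := hQ (z + ε • Pi.single v 1)
      have hlin : ∀ w, adjSum G (z + ε • Pi.single v 1) w =
          adjSum G z w + ε * adjSum G (Pi.single v 1) w := by
        intro w
        simp only [adjSum, Finset.mul_sum, ← Finset.sum_add_distrib]
        refine Finset.sum_congr rfl fun x _ => ?_
        split_ifs <;> simp
      have e1 : Q (z + ε • Pi.single v 1) =
          Q z + 2 * ε * adjSum G z v + ε * ε * Q (Pi.single v 1) := by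
        have h1 : ∑ w, adjSum G z w * (Pi.single v 1 : V → ℝ) w = adjSum G z v := by
          simp [Pi.single_apply]
        have h2 : ∑ w, adjSum G (Pi.single v 1) w * z w = adjSum G z v := by
          rw [sum_adjSum_mul_comm, h1]
        simp only [Q, hlin, Pi.add_apply, Pi.smul_apply, smul_eq_mul]
        calc _ = ∑ w, (adjSum G z w * z w + ε * (adjSum G z w * (Pi.single v 1 : V → ℝ) w) +
              ε * (adjSum G (Pi.single v 1) w * z w) +
              ε * ε * (adjSum G (Pi.single v 1) w * (Pi.single v 1 : V → ℝ) w)) :=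
              Finset.sum_congr rfl fun w _ => by ring
          _ = _ := by
              simp only [Finset.sum_add_distrib, ← Finset.mul_sum, h1, h2]
              ring
      have e2 : ∑ w, (z + ε • Pi.single v 1 : V → ℝ) w ^ 2 = 1 + 2 * ε * z v + ε * ε := by
        have h1 : ∑ w, z w * (Pi.single v 1 : V → ℝ) w = z v := by simp [Pi.single_apply]
        have h2 : ∑ w, (Pi.single v 1 : V → ℝ) w ^ 2 = 1 := by simp [Pi.single_apply]
        simp only [Pi.add_apply, Pi.smul_apply, smul_eq_mul]
        calc _ = ∑ w, (z w ^ 2 + 2 * ε * (z w * (Pi.single v 1 : V → ℝ) w) +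
              ε * ε * (Pi.single v 1 : V → ℝ) w ^ 2) := Finset.sum_congr rfl fun w _ => by ring
          _ = _ := by
              simp only [Finset.sum_add_distrib, ← Finset.mul_sum, h1, h2, hz1]
              ring
      rw [e1, e2] at h
      linarith
    have hd := discrim_le_zero key
    simp only [discrim, mul_zero, sub_zero] at hd
    have := pow_eq_zero_iff (two_ne_zero) |>.mp (le_antisymm hd (sq_nonneg _))
    linarith

/-- A zero entry forces the nonnegative neighbour sum there to vanish, so zeros spread along walks
to all of a connected graph. -/
lemma exists_pos_eigenvector {V : Type*} [Fintype V] {G : SimpleGraph V} (hG : G.Connected) :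
    ∃ (l : ℝ) (z : V → ℝ), (∀ v, 0 < z v) ∧ ∀ v, adjSum G z v = l * z v := by
  have := hG.nonempty
  obtain ⟨l, z, h0, ⟨v₀, hv₀⟩, h⟩ := exists_nonneg_eigenvector G
  refine ⟨l, z, fun v => ?_, h⟩
  by_contra hlt
  have hv : z v = 0 := le_antisymm (not_lt.mp hlt) (h0 v)
  clear hlt
  have step : ∀ a b, G.Adj a b → z a = 0 → z b = 0 := by
    intro a b hab ha
    have h1 := h a
    rw [ha, mul_zero, adjSum, Finset.sum_eq_zero_iff_of_nonneg] at h1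
    · simpa [hab] using h1 b (Finset.mem_univ b)
    · intro w _
      split_ifs
      exacts [h0 w, le_rfl]
  obtain ⟨p⟩ := hG.preconnected v v₀
  apply hv₀
  clear hv₀
  induction p with
  | nil => exact hv
  | cons hadj _ ih => exact ih (step _ _ hadj hv)

lemma hasGrowthRate_of_pos_eigenvector {t u : ℕ} (M : CellMatrix t u)
    [Nonempty (Fin t ⊕ Fin u)] {z : Fin t ⊕ Fin u → ℝ} (hz : ∀ v, 0 < z v) {l : ℝ}
    (h : ∀ v, adjSum (rowColumnGraph M) z v = l * z v) : HasGrowthRate (Grid M) (l ^ 2) := by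
  refine hasGrowthRate_sq_of_eigenvector M (x := z ∘ Sum.inl) (y := z ∘ Sum.inr)
    (fun _ => hz _) (fun _ => hz _) (fun i => ?_) (fun j => ?_) inferInstance
  · have := h (Sum.inl i)
    rw [adjSum, Fintype.sum_sum_type] at this
    simp [rowColumnGraph] at this
    refine Eq.trans (Finset.sum_congr rfl fun j _ => ?_) this
    by_cases h : M i j = 0 <;> simp [h]
  · have := h (Sum.inr j)
    rw [adjSum, Fintype.sum_sum_type] at this
    simp [rowColumnGraph] at this
    refine Eq.trans (Finset.sum_congr rfl fun i _ => ?_) this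
    by_cases h : M i j = 0 <;> simp [h]

/-! ### Paths and the staircase -/

/-- The addition formula for sine; the missing neighbours at the two ends would contribute `sin 0`
and `sin π`. -/
lemma adjSum_pathGraph_sin {n : ℕ} (v : Fin (n + 1)) :
    adjSum (SimpleGraph.pathGraph (n + 1))
      (fun w => Real.sin (((w : ℕ) + 1 : ℝ) * (Real.pi / ((n : ℝ) + 2)))) v =
      2 * Real.cos (Real.pi / ((n : ℝ) + 2)) *
        Real.sin (((v : ℕ) + 1 : ℝ) * (Real.pi / ((n : ℝ) + 2))) := by
  classical
  set θ := Real.pi / ((n : ℝ) + 2) with hθ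
  have hπ : ((n : ℝ) + 2) * θ = Real.pi := by rw [hθ]; field_simp
  have e : adjSum (SimpleGraph.pathGraph (n + 1))
      (fun w => Real.sin (((w : ℕ) + 1 : ℝ) * θ)) v =
      (∑ w : Fin (n + 1), if (v : ℕ) + 1 = w then Real.sin (((w : ℕ) + 1 : ℝ) * θ) else 0) +
      ∑ w : Fin (n + 1), if (w : ℕ) + 1 = v then Real.sin (((w : ℕ) + 1 : ℝ) * θ) else 0 := by
    rw [adjSum, ← Finset.sum_add_distrib]
    refine Finset.sum_congr rfl fun w _ => ?_
    simp only [SimpleGraph.pathGraph_adj]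
    by_cases h1 : (v : ℕ) + 1 = w
    · have h2 : ¬ (w : ℕ) + 1 = v := by omega
      simp [h1, h2]
    · simp [h1]
  have e1 : (∑ w : Fin (n + 1), if (v : ℕ) + 1 = w then Real.sin (((w : ℕ) + 1 : ℝ) * θ) else 0) =
      Real.sin (((v : ℕ) + 2 : ℝ) * θ) := by
    by_cases hv : (v : ℕ) + 1 < n + 1
    · rw [Finset.sum_eq_single ⟨v + 1, hv⟩]
      · rw [if_pos rfl]
        congr 1
        push_cast
        ring
      · intro w _ hw
        rw [if_neg]
        intro h
        exact hw (Fin.ext h.symm)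
      · simp
    · have hvn : (v : ℕ) = n := by omega
      rw [hvn, hπ, Real.sin_pi]
      exact Finset.sum_eq_zero fun w _ => if_neg (by omega)
  have e2 : (∑ w : Fin (n + 1), if (w : ℕ) + 1 = v then Real.sin (((w : ℕ) + 1 : ℝ) * θ) else 0) =
      Real.sin ((v : ℕ) * θ) := by
    rcases Nat.eq_zero_or_pos (v : ℕ) with hv | hv
    · rw [hv, Nat.cast_zero, zero_mul, Real.sin_zero]
      exact Finset.sum_eq_zero fun w _ => if_neg (by omega)
    · obtain ⟨a, ha⟩ := Nat.exists_eq_succ_of_ne_zero hv.ne'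
      rw [Finset.sum_eq_single ⟨a, by omega⟩]
      · rw [if_pos ha.symm, ha]
        push_cast
        rfl
      · intro w _ hw
        rw [if_neg]
        intro h
        exact hw (Fin.ext (by simp only; omega))
      · simp
  rw [e, e1, e2, show ((v : ℕ) + 2 : ℝ) * θ = ((v : ℕ) + 1 : ℝ) * θ + θ by ring,
    show ((v : ℕ) : ℝ) * θ = ((v : ℕ) + 1 : ℝ) * θ - θ by ring, Real.sin_add, Real.sin_sub]
  ring

lemma adjSum_iso {V W : Type*} [Fintype V] [Fintype W] {G : SimpleGraph V} {H : SimpleGraph W}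
    (f : G ≃g H) (z : W → ℝ) (v : V) : adjSum G (z ∘ f) v = adjSum H z (f v) := by
  classical
  simp only [adjSum]
  refine Fintype.sum_equiv f.toEquiv _ _ fun w => ?_
  have hadj : H.Adj (f v) (f w) ↔ G.Adj v w := f.map_adj_iff
  by_cases h : G.Adj v w
  · rw [if_pos h]
    exact (if_pos (hadj.mpr h)).symm
  · rw [if_neg h]
    exact (if_neg (hadj.not.mpr h)).symm

lemma size_eq_card_edgeSet {t u : ℕ} (M : CellMatrix t u) :
    size M = Nat.card (rowColumnGraph M).edgeSet := by
  classical
  rw [Nat.card_eq_fintype_card, ← SimpleGraph.edgeFinset_card, size]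
  refine Finset.card_bij (fun p _ => s(Sum.inl p.1, Sum.inr p.2)) ?_ ?_ ?_
  · intro p hp
    rw [SimpleGraph.mem_edgeFinset]
    exact (Finset.mem_filter.mp hp).2
  · intro p _ q _ h
    simpa [Prod.ext_iff] using h
  · intro e he
    rw [SimpleGraph.mem_edgeFinset] at he
    induction e with | h a b => ?_
    rcases a with i | j <;> rcases b with i' | j'
    · exact absurd he (by simp [rowColumnGraph])
    · exact ⟨(i, j'), Finset.mem_filter.mpr ⟨Finset.mem_univ _, he⟩, rfl⟩
    · exact ⟨(i', j), Finset.mem_filter.mpr ⟨Finset.mem_univ _, he⟩, Sym2.eq_swap⟩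
    · exact absurd he (by simp [rowColumnGraph])

lemma card_edgeSet_pathGraph (n : ℕ) :
    Nat.card (SimpleGraph.pathGraph (n + 1)).edgeSet = n := by
  classical
  rw [Nat.card_eq_fintype_card, ← SimpleGraph.edgeFinset_card]
  conv_rhs => rw [← Fintype.card_fin n, ← Finset.card_univ]
  symm
  refine Finset.card_bij (fun k _ => s(k.castSucc, k.succ)) ?_ ?_ ?_
  · intro k _
    rw [SimpleGraph.mem_edgeFinset, SimpleGraph.mem_edgeSet, SimpleGraph.pathGraph_adj]
    simp
  · intro a _ b _ h
    simp only [Sym2.eq_iff, Fin.ext_iff, Fin.val_castSucc, Fin.val_succ] at h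
    exact Fin.ext (by omega)
  · intro e he
    rw [SimpleGraph.mem_edgeFinset] at he
    induction e with | h a b => ?_
    rw [SimpleGraph.mem_edgeSet, SimpleGraph.pathGraph_adj] at he
    rcases he with h | h
    · refine ⟨⟨a, by omega⟩, Finset.mem_univ _, ?_⟩
      exact Sym2.eq_iff.mpr (Or.inl ⟨Fin.ext rfl, Fin.ext h⟩)
    · refine ⟨⟨b, by omega⟩, Finset.mem_univ _, ?_⟩
      exact Sym2.eq_iff.mpr (Or.inr ⟨Fin.ext rfl, Fin.ext h⟩)

theorem hasGrowthRate_of_isPathGraph {t u : ℕ} {M : CellMatrix t u}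
    (h : IsPathGraph (rowColumnGraph M)) :
    HasGrowthRate (Grid M) (4 * Real.cos (Real.pi / ((size M : ℝ) + 2)) ^ 2) := by
  classical
  obtain ⟨n, ⟨f⟩⟩ := h
  have hn : size M = n := by
    rw [size_eq_card_edgeSet, Nat.card_congr f.mapEdgeSet, card_edgeSet_pathGraph]
  have : Nonempty (Fin t ⊕ Fin u) := ⟨f.symm 0⟩
  rw [hn, show 4 * Real.cos (Real.pi / ((n : ℝ) + 2)) ^ 2 =
    (2 * Real.cos (Real.pi / ((n : ℝ) + 2))) ^ 2 by ring]
  refine hasGrowthRate_of_pos_eigenvector M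
    (z := (fun w : Fin (n + 1) => Real.sin (((w : ℕ) + 1 : ℝ) * (Real.pi / ((n : ℝ) + 2)))) ∘ f)
    (fun v => ?_) (fun v => ?_)
  · refine Real.sin_pos_of_pos_of_lt_pi (by positivity) ?_
    have hw : ((f v : ℕ) : ℝ) ≤ n := Nat.cast_le.mpr (by omega)
    rw [← mul_div_assoc, div_lt_iff₀ (by positivity), mul_comm]
    exact mul_lt_mul_of_pos_left (by linarith) Real.pi_pos
  · rw [adjSum_iso, adjSum_pathGraph_sin]
    rfl

/-- The staircase matrix whose row-column graph is a path with `m` edges. -/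
def staircase (m : ℕ) : CellMatrix (m / 2 + 1) ((m + 1) / 2) :=
  fun i j => if (j : ℕ) = i ∨ (j : ℕ) + 1 = i then 1 else 0

lemma isPathGraph_staircase (m : ℕ) : IsPathGraph (rowColumnGraph (staircase m)) := by
  -- Columns become the even vertices of the path and rows the odd ones.
  refine ⟨m, ⟨⟨⟨Sum.elim (fun i : Fin (m / 2 + 1) => (⟨2 * i, by omega⟩ : Fin (m + 1)))
      (fun j : Fin ((m + 1) / 2) => ⟨2 * j + 1, by omega⟩),
    fun w => if h : (w : ℕ) % 2 = 0 then Sum.inl ⟨w / 2, by omega⟩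
      else Sum.inr ⟨w / 2, by omega⟩, ?_, ?_⟩, ?_⟩⟩⟩
  · rintro (i | j)
    · simp
    · have : ¬ (2 * (j : ℕ) + 1) % 2 = 0 := by omega
      exact (dif_neg this).trans <|
        congrArg Sum.inr (Fin.ext (show (2 * (j : ℕ) + 1) / 2 = j by omega))
  · intro w
    by_cases h : (w : ℕ) % 2 = 0
    · simp only [h, dif_pos, Sum.elim_inl]
      exact Fin.ext (by simp only; omega)
    · simp only [h, dif_neg, not_false_eq_true, Sum.elim_inr]
      exact Fin.ext (by simp only; omega)
  · rintro (i | j) (i' | j')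
    · rw [SimpleGraph.pathGraph_adj]
      refine iff_of_false ?_ id
      simp only [Equiv.coe_fn_mk, Sum.elim_inl]
      omega
    · simp only [Equiv.coe_fn_mk, Sum.elim_inl, Sum.elim_inr, SimpleGraph.pathGraph_adj,
        rowColumnGraph, staircase, ne_eq, ite_eq_right_iff, one_ne_zero, imp_false, not_not]
      omega
    · simp only [Equiv.coe_fn_mk, Sum.elim_inl, Sum.elim_inr, SimpleGraph.pathGraph_adj,
        rowColumnGraph, staircase, ne_eq, ite_eq_right_iff, one_ne_zero, imp_false, not_not]
      omega
    · rw [SimpleGraph.pathGraph_adj]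
      refine iff_of_false ?_ id
      simp only [Equiv.coe_fn_mk, Sum.elim_inr]
      omega

lemma size_staircase (m : ℕ) : size (staircase m) = m := by
  classical
  have h : Nat.card (Fin (m / 2 + 1) ⊕ Fin ((m + 1) / 2)) = m + 1 := by
    simp
    omega
  obtain ⟨n, ⟨f⟩⟩ := isPathGraph_staircase m
  rw [size_eq_card_edgeSet, Nat.card_congr f.mapEdgeSet, card_edgeSet_pathGraph]
  rw [Nat.card_congr f.toEquiv, Nat.card_eq_fintype_card, Fintype.card_fin] at h
  omega

lemma IsPathGraph.connected {V : Type*} {G : SimpleGraph V} (h : IsPathGraph G) :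
    G.Connected := by
  obtain ⟨n, ⟨f⟩⟩ := h
  exact f.connected_iff.mpr (SimpleGraph.pathGraph_connected n)

/-! ### Comparing trees with paths -/

/-- The ratio of consecutive entries of the sine eigenvector of a path. -/
noncomputable def sinRatio (θ : ℝ) (e : ℕ) : ℝ := Real.sin (e * θ) / Real.sin (((e : ℝ) + 1) * θ)

lemma sin_nat_mul_pos {θ : ℝ} (hθ : 0 < θ) {m e : ℕ} (hm : ((m : ℝ) + 2) * θ = Real.pi)
    (h0 : 0 < e) (he : e ≤ m + 1) : 0 < Real.sin (e * θ) := by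
  have h1 : (e : ℝ) ≤ m + 1 := by exact_mod_cast he
  have h2 : (0 : ℝ) < e := Nat.cast_pos.mpr h0
  refine Real.sin_pos_of_pos_of_lt_pi (by positivity) ?_
  rw [← hm]
  exact mul_lt_mul_of_pos_right (by linarith) hθ

lemma sin_succ_mul_pos {θ : ℝ} (hθ : 0 < θ) {m e : ℕ} (hm : ((m : ℝ) + 2) * θ = Real.pi)
    (he : e ≤ m) : 0 < Real.sin (((e : ℝ) + 1) * θ) := by
  have := sin_nat_mul_pos hθ hm (Nat.succ_pos e) (Nat.succ_le_succ he)
  simpa using this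

lemma sin_nat_mul_nonneg {θ : ℝ} (hθ : 0 < θ) {m e : ℕ} (hm : ((m : ℝ) + 2) * θ = Real.pi)
    (he : e ≤ m + 2) : 0 ≤ Real.sin (e * θ) := by
  have h1 : (e : ℝ) ≤ m + 2 := by exact_mod_cast he
  refine Real.sin_nonneg_of_nonneg_of_le_pi (by positivity) ?_
  rw [← hm]
  exact mul_le_mul_of_nonneg_right h1 hθ.le

lemma sinRatio_nonneg {θ : ℝ} (hθ : 0 < θ) {m e : ℕ} (hm : ((m : ℝ) + 2) * θ = Real.pi)
    (he : e ≤ m) : 0 ≤ sinRatio θ e :=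
  div_nonneg (sin_nat_mul_nonneg hθ hm (by omega)) (sin_succ_mul_pos hθ hm he).le

/-- After clearing denominators the difference is `sin ((a + b + 2) * θ) * sin (a * θ) * sin (b *
θ)`, nonnegative as all angles lie in `[0, π]`. It says that splitting the edges between two
branches at the root does not lower the bound. -/
lemma sinRatio_add_le {θ : ℝ} (hθ : 0 < θ) {m a b : ℕ} (hm : ((m : ℝ) + 2) * θ = Real.pi)
    (hab : a + b ≤ m) : sinRatio θ (a + b) ≤ sinRatio θ a + sinRatio θ b := by
  have hA := sin_succ_mul_pos hθ hm (show a ≤ m by omega)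
  have hB := sin_succ_mul_pos hθ hm (show b ≤ m by omega)
  have hC := sin_succ_mul_pos hθ hm hab
  have h1 := sin_nat_mul_nonneg hθ hm (show a ≤ m + 2 by omega)
  have h2 := sin_nat_mul_nonneg hθ hm (show b ≤ m + 2 by omega)
  have h3 := sin_nat_mul_nonneg hθ hm (show a + b + 2 ≤ m + 2 by omega)
  have identity : Real.sin (a * θ) * Real.sin (((b : ℝ) + 1) * θ) *
        Real.sin (((a + b : ℕ) + 1 : ℝ) * θ) +
      Real.sin (b * θ) * Real.sin (((a : ℝ) + 1) * θ) * Real.sin (((a + b : ℕ) + 1 : ℝ) * θ) -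
      Real.sin ((a + b : ℕ) * θ) * Real.sin (((a : ℝ) + 1) * θ) * Real.sin (((b : ℝ) + 1) * θ) =
      Real.sin ((a + b + 2 : ℕ) * θ) * Real.sin (a * θ) * Real.sin (b * θ) := by
    rw [show ((a : ℝ) + 1) * θ = a * θ + θ by ring, show ((b : ℝ) + 1) * θ = b * θ + θ by ring,
      show ((a + b : ℕ) + 1 : ℝ) * θ = (a * θ + b * θ) + θ by push_cast; ring,
      show ((a + b : ℕ) : ℝ) * θ = a * θ + b * θ by push_cast; ring,
      show ((a + b + 2 : ℕ) : ℝ) * θ = (a * θ + b * θ) + θ + θ by push_cast; ring]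
    have ha := Real.sin_sq_add_cos_sq (a * θ)
    have hb := Real.sin_sq_add_cos_sq (b * θ)
    have hc := Real.sin_sq_add_cos_sq θ
    simp only [Real.sin_add, Real.cos_add]
    generalize Real.sin (a * θ) = sa at *
    generalize Real.cos (a * θ) = ca at *
    generalize Real.sin (b * θ) = sb at *
    generalize Real.cos (b * θ) = cb at *
    generalize Real.sin θ = s at *
    generalize Real.cos θ = c at *
    clear hm hA hB hC h1 h2 h3 hθ
    grind
  have h4 := mul_nonneg (mul_nonneg h3 h1) h2
  rw [← identity] at h4
  simp only [sinRatio]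
  rw [div_add_div _ _ hA.ne' hB.ne', div_le_div_iff₀ hC (mul_pos hA hB)]
  linarith

/-- The three-term recurrence of the sines, which describes lengthening a branch by one edge at its
root. -/
lemma sinRatio_succ_mul {θ : ℝ} (hθ : 0 < θ) {m b : ℕ} (hm : ((m : ℝ) + 2) * θ = Real.pi)
    (hb : b + 1 ≤ m) : sinRatio θ (b + 1) * (2 * Real.cos θ - sinRatio θ b) = 1 := by
  have hB := sin_succ_mul_pos hθ hm (show b ≤ m by omega)
  have hC := sin_succ_mul_pos hθ hm hb
  have h : Real.sin (((b + 1 : ℕ) + 1 : ℝ) * θ) =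
      2 * Real.cos θ * Real.sin (((b : ℝ) + 1) * θ) - Real.sin (b * θ) := by
    rw [show ((b + 1 : ℕ) + 1 : ℝ) * θ = ((b : ℝ) + 1) * θ + θ by push_cast; ring,
      show (b : ℝ) * θ = ((b : ℝ) + 1) * θ - θ by ring, Real.sin_add, Real.sin_sub]
    ring
  have h' : 2 * Real.cos θ - sinRatio θ b =
      Real.sin (((b + 1 : ℕ) + 1 : ℝ) * θ) / Real.sin (((b : ℝ) + 1) * θ) := by
    rw [h, sinRatio, sub_div, mul_div_assoc, div_self hB.ne', mul_one]
  rw [h', sinRatio, div_mul_div_comm, Nat.cast_succ, mul_comm]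
  rw [Nat.cast_succ] at hC
  exact div_self (mul_pos hC hB).ne'

lemma sinRatio_last {θ : ℝ} (hθ : 0 < θ) {m : ℕ} (hm : ((m : ℝ) + 2) * θ = Real.pi) :
    sinRatio θ m = 2 * Real.cos θ := by
  have h0 : 0 < Real.sin θ := by
    have := sin_nat_mul_pos hθ hm one_pos (by omega)
    simpa using this
  rw [sinRatio, show (m : ℝ) * θ = Real.pi - 2 * θ by linarith,
    show ((m : ℝ) + 1) * θ = Real.pi - θ by linarith, Real.sin_pi_sub, Real.sin_pi_sub,
    Real.sin_two_mul]
  field_simp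

lemma reachable_iff_reachable_deleteEdges {V : Type*} {H : SimpleGraph V} {r w : V}
    (h : H.Adj r w) (v : V) : H.Reachable r v ↔
      (H.deleteEdges {s(r, w)}).Reachable r v ∨ (H.deleteEdges {s(r, w)}).Reachable w v := by
  constructor
  · intro hv
    rw [SimpleGraph.reachable_iff_reflTransGen] at hv
    induction hv with
    | refl => exact Or.inl (SimpleGraph.Reachable.refl r)
    | @tail b c _ hbc ih =>
      by_cases he : s(b, c) = s(r, w)
      · rcases Sym2.eq_iff.mp he with ⟨-, rfl⟩ | ⟨-, rfl⟩
        exacts [Or.inr (SimpleGraph.Reachable.refl _), Or.inl (SimpleGraph.Reachable.refl _)]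
      · have hbc' : (H.deleteEdges {s(r, w)}).Adj b c :=
          SimpleGraph.deleteEdges_adj.mpr ⟨hbc, he⟩
        exact ih.imp (·.trans hbc'.reachable) (·.trans hbc'.reachable)
  · rintro (hv | hv)
    · exact hv.mono (SimpleGraph.deleteEdges_le _)
    · exact h.reachable.trans (hv.mono (SimpleGraph.deleteEdges_le _))

lemma adjSum_deleteEdges {V : Type*} [Fintype V] {H : SimpleGraph V} {r w : V} (h : H.Adj r w)
    (z : V → ℝ) : adjSum H z r = adjSum (H.deleteEdges {s(r, w)}) z r + z w := by
  classical
  have : z w = ∑ x, if x = w then z x else 0 := by simp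
  rw [this]
  simp only [adjSum]
  rw [← Finset.sum_add_distrib]
  refine Finset.sum_congr rfl fun x _ => ?_
  by_cases hx : x = w
  · subst hx
    simp [h]
  · have hrw : r ≠ w := h.ne
    simp [hx, hrw]

lemma adjSum_deleteEdges_of_ne {V : Type*} [Fintype V] {H : SimpleGraph V} {r w v : V}
    (hr : v ≠ r) (hw : v ≠ w) (z : V → ℝ) :
    adjSum (H.deleteEdges {s(r, w)}) z v = adjSum H z v := by
  have h : ∀ x, (H.deleteEdges {s(r, w)}).Adj v x ↔ H.Adj v x := fun x => by simp [hr, hw]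
  refine Finset.sum_congr rfl fun x _ => ?_
  by_cases hx : H.Adj v x
  · exact (if_pos ((h x).mpr hx)).trans (if_pos hx).symm
  · exact (if_neg ((h x).not.mpr hx)).trans (if_neg hx).symm

/-- A positive vector which is superharmonic (for the eigenvalue `2 * cos θ`) away from the root
of a tree has, at the root, at least the neighbor sum it would have at the end of a path. -/
lemma sinRatio_mul_le_adjSum {V : Type*} [Fintype V] {θ : ℝ} (hθ : 0 < θ) {m : ℕ}
    (hm : ((m : ℝ) + 2) * θ = Real.pi) {z : V → ℝ} (hz : ∀ v, 0 < z v) (n : ℕ) (hn : n ≤ m)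
    (H : SimpleGraph V) (hH : H.IsAcyclic) (r : V) (hc : Nat.card {v // H.Reachable r v} = n + 1)
    (hs : ∀ v, H.Reachable r v → v ≠ r → adjSum H z v ≤ 2 * Real.cos θ * z v) :
    sinRatio θ n * z r ≤ adjSum H z r := by
  induction n using Nat.strong_induction_on generalizing H r with
  | _ n ih =>
  rcases Nat.eq_zero_or_pos n with rfl | hn0
  · have := adjSum_nonneg H (fun v => (hz v).le) r
    simpa [sinRatio] using this
  obtain ⟨w, hw⟩ : ∃ w, H.Adj r w := by
    by_contra! hno
    have huniq : ∀ v, H.Reachable r v → v = r := by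
      rintro v ⟨p⟩
      cases p with
      | nil => rfl
      | cons h _ => exact absurd h (hno _)
    have : Subsingleton {v // H.Reachable r v} :=
      ⟨fun a b => Subtype.ext ((huniq _ a.2).trans (huniq _ b.2).symm)⟩
    have := Finite.card_le_one_iff_subsingleton.mpr this
    omega
  -- In an acyclic graph the edge `rw` is a bridge, so deleting it splits the component of `r` into
  -- two smaller rooted trees.
  have hbr : ¬ (H.deleteEdges {s(r, w)}).Reachable r w :=
    SimpleGraph.isBridge_iff.mp (SimpleGraph.isAcyclic_iff_forall_adj_isBridge.mp hH hw)
  have hreach := reachable_iff_reachable_deleteEdges hw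
  have hsum := adjSum_deleteEdges hw z
  have hsum' := adjSum_deleteEdges hw.symm z
  rw [Sym2.eq_swap] at hsum'
  have hne := fun v (hr : v ≠ r) (hw : v ≠ w) => adjSum_deleteEdges_of_ne (H := H) hr hw z
  have hH' : (H.deleteEdges {s(r, w)}).IsAcyclic := hH.anti (SimpleGraph.deleteEdges_le _)
  generalize H.deleteEdges {s(r, w)} = H' at *
  have hcard : Nat.card {v // H.Reachable r v} =
      Nat.card {v // H'.Reachable r v} + Nat.card {v // H'.Reachable w v} := by
    classical
    simp only [Nat.card_eq_fintype_card, hreach]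
    refine Fintype.card_subtype_or_disjoint _ _ ?_
    rw [Pi.disjoint_iff]
    intro v
    rw [Prop.disjoint_iff]
    by_contra! h
    exact hbr (h.1.trans h.2.symm)
  have hposr : 0 < Nat.card {v // H'.Reachable r v} :=
    have : Nonempty {v // H'.Reachable r v} := ⟨⟨r, SimpleGraph.Reachable.refl r⟩⟩
    Nat.card_pos
  have hposw : 0 < Nat.card {v // H'.Reachable w v} :=
    have : Nonempty {v // H'.Reachable w v} := ⟨⟨w, SimpleGraph.Reachable.refl w⟩⟩
    Nat.card_pos
  obtain ⟨a, ha⟩ := Nat.exists_eq_succ_of_ne_zero hposr.ne'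
  obtain ⟨b, hb⟩ := Nat.exists_eq_succ_of_ne_zero hposw.ne'
  -- `n`, `a`, `b` count vertices minus one; the extra 1 is the deleted edge.
  have hnab : n = a + (b + 1) := by omega
  have iha := ih a (by omega) (by omega) H' hH' r ha fun v hv hvr => by
    rw [hne v hvr (by rintro rfl; exact hbr hv)]
    exact hs v ((hreach v).mpr (Or.inl hv)) hvr
  have ihb := ih b (by omega) (by omega) H' hH' w hb fun v hv hvw => by
    have hvr : v ≠ r := by rintro rfl; exact hbr hv.symm
    rw [hne v hvr hvw]
    exact hs v ((hreach v).mpr (Or.inr hv)) hvr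
  -- Superharmonicity at `w`, whose neighbour sum is `z r` plus the part already bounded below by
  -- `ihb`, bounds `z w` below in terms of `z r`.
  have h1 := hs w hw.reachable hw.ne'
  have h2 : z r ≤ (2 * Real.cos θ - sinRatio θ b) * z w := by linarith
  have h3 : sinRatio θ (b + 1) * z r ≤ z w := by
    have := mul_le_mul_of_nonneg_left h2
      (sinRatio_nonneg hθ hm (show b + 1 ≤ m by omega))
    rwa [← mul_assoc, sinRatio_succ_mul hθ hm (by omega), one_mul] at this
  have h4 := mul_le_mul_of_nonneg_right (sinRatio_add_le hθ hm (hnab ▸ hn)) (hz r).le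
  rw [hnab]
  linarith

/-! ### Minimality among connected graphs -/

lemma sum_adjSum_one {V : Type*} [Fintype V] (G : SimpleGraph V) :
    ∑ v, adjSum G 1 v = 2 * Nat.card G.edgeSet := by
  classical
  have h := G.sum_degrees_eq_twice_card_edges
  rw [Nat.card_eq_fintype_card, ← SimpleGraph.edgeFinset_card]
  have e : ∀ v, adjSum G 1 v = G.degree v := by
    intro v
    rw [← SimpleGraph.card_neighborFinset_eq_degree, SimpleGraph.neighborFinset_eq_filter]
    simp [adjSum]
  simp only [e]
  exact_mod_cast h

/-- Summing the eigenvalue equation divided by `z v` gives `l` times the number of vertices, while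
each edge contributes `z w / z v + z v / z w ≥ 2`. -/
lemma two_mul_card_edgeSet_le {V : Type*} [Fintype V] {G : SimpleGraph V} {l : ℝ} {z : V → ℝ}
    (hz : ∀ v, 0 < z v) (h : ∀ v, adjSum G z v = l * z v) :
    2 * (Nat.card G.edgeSet : ℝ) ≤ l * Fintype.card V := by
  classical
  have e1 : ∑ v, ∑ w, (if G.Adj v w then z w / z v else 0) = l * Fintype.card V := by
    have : ∀ v, ∑ w, (if G.Adj v w then z w / z v else 0) = l := by
      intro v
      have h1 : ∀ w, (if G.Adj v w then z w / z v else 0) = (if G.Adj v w then z w else 0) / z v :=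
        fun w => by split_ifs <;> simp
      have h2 := h v
      simp only [adjSum] at h2
      simp only [h1]
      rw [← Finset.sum_div, h2, mul_div_assoc, div_self (hz v).ne', mul_one]
    simp [this, mul_comm]
  have e2 : ∑ v, ∑ w, (if G.Adj v w then z v / z w else 0) = l * Fintype.card V := by
    rw [← e1, Finset.sum_comm]
    simp only [G.adj_comm]
  have e3 : 2 * ∑ v, adjSum G 1 v ≤ ∑ v, ∑ w, (if G.Adj v w then z w / z v else 0) +
      ∑ v, ∑ w, (if G.Adj v w then z v / z w else 0) := by
    simp only [adjSum, Finset.mul_sum, ← Finset.sum_add_distrib]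
    refine Finset.sum_le_sum fun v _ => Finset.sum_le_sum fun w _ => ?_
    split_ifs
    · have h1 := hz v
      have h2 := hz w
      rw [div_add_div _ _ h1.ne' h2.ne', le_div_iff₀ (mul_pos h1 h2), Pi.one_apply]
      nlinarith [sq_nonneg (z v - z w)]
    · simp
  rw [e1, e2, sum_adjSum_one] at e3
  linarith

theorem two_mul_cos_le_of_pos_eigenvector {V : Type*} [Fintype V] {G : SimpleGraph V}
    (hG : G.Connected) {m : ℕ} (hm : Nat.card G.edgeSet = m) {l : ℝ} {z : V → ℝ}
    (hz : ∀ v, 0 < z v) (h : ∀ v, adjSum G z v = l * z v) :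
    2 * Real.cos (Real.pi / ((m : ℝ) + 2)) ≤ l := by
  obtain ⟨r⟩ := hG.nonempty
  have hle := hG.card_vert_le_card_edgeSet_add_one
  rw [hm] at hle
  rcases hle.lt_or_eq with hlt | heq
  · have h1 := two_mul_card_edgeSet_le hz h
    rw [hm, ← Nat.card_eq_fintype_card] at h1
    have h2 : (Nat.card V : ℝ) ≤ m := by exact_mod_cast Nat.lt_succ_iff.mp hlt
    have h3 : (0 : ℝ) < Nat.card V := by
      have : Nonempty V := ⟨r⟩
      exact_mod_cast Nat.card_pos
    have h4 : 2 ≤ l := by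
      by_contra! hl
      nlinarith
    linarith [Real.cos_le_one (Real.pi / ((m : ℝ) + 2))]
  · have htree : G.IsTree := by
      rw [SimpleGraph.isTree_iff_connected_and_card, hm]
      exact ⟨hG, heq.symm⟩
    -- If `l < 2 * cos θ`, then `z` is superharmonic everywhere, and the comparison with `n = m`,
    -- where the ratio equals `2 * cos θ`, contradicts the equation at `r`.
    by_contra! hl
    have hθ : 0 < Real.pi / ((m : ℝ) + 2) := by positivity
    have hmθ : ((m : ℝ) + 2) * (Real.pi / ((m : ℝ) + 2)) = Real.pi := by field_simp
    have hc : Nat.card {v // G.Reachable r v} = m + 1 := by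
      rw [← heq]
      exact Nat.card_congr (Equiv.subtypeUnivEquiv fun v => hG.preconnected r v)
    have := sinRatio_mul_le_adjSum hθ hmθ hz m le_rfl G htree.isAcyclic r hc fun v _ _ => by
      rw [h]
      exact mul_le_mul_of_nonneg_right hl.le (hz v).le
    rw [sinRatio_last hθ hmθ, h] at this
    exact absurd (le_of_mul_le_mul_right this (hz r)) (not_le.mpr hl)

end GridClass

theorem mainTheorem8 (m : ℕ) :
    (∀ (t u : ℕ) (M : GridClass.CellMatrix t u), GridClass.size M = m →
      GridClass.IsPathGraph (GridClass.rowColumnGraph M) →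
      GridClass.HasGrowthRate (GridClass.Grid M) (4 * Real.cos (Real.pi / ((m : ℝ) + 2)) ^ 2)) ∧
    (∀ (t u : ℕ) (M : GridClass.CellMatrix t u), GridClass.size M = m →
      (GridClass.rowColumnGraph M).Connected →
      ∃ g : ℝ, GridClass.HasGrowthRate (GridClass.Grid M) g) ∧
    IsLeast {g : ℝ | ∃ (t u : ℕ) (M : GridClass.CellMatrix t u), GridClass.size M = m ∧
        (GridClass.rowColumnGraph M).Connected ∧ GridClass.HasGrowthRate (GridClass.Grid M) g}
      (4 * Real.cos (Real.pi / ((m : ℝ) + 2)) ^ 2) := by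
  refine ⟨?_, ?_, ⟨_, _, GridClass.staircase m, GridClass.size_staircase m,
    (GridClass.isPathGraph_staircase m).connected, ?_⟩, ?_⟩
  · rintro t u M rfl hM
    exact GridClass.hasGrowthRate_of_isPathGraph hM
  · intro t u M _ hM
    obtain ⟨l, z, hz, h⟩ := GridClass.exists_pos_eigenvector hM
    have := hM.nonempty
    exact ⟨l ^ 2, GridClass.hasGrowthRate_of_pos_eigenvector M hz h⟩
  · have := GridClass.hasGrowthRate_of_isPathGraph (GridClass.isPathGraph_staircase m)
    rwa [GridClass.size_staircase] at this
  · rintro g ⟨t, u, M, hm, hM, hg⟩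
    obtain ⟨l, z, hz, h⟩ := GridClass.exists_pos_eigenvector hM
    have := hM.nonempty
    rw [tendsto_nhds_unique hg (GridClass.hasGrowthRate_of_pos_eigenvector M hz h)]
    have hl := GridClass.two_mul_cos_le_of_pos_eigenvector hM
      ((GridClass.size_eq_card_edgeSet M).symm.trans hm) hz h
    -- Nonnegativity of the cosine allows `2 * cos ≤ l` to be squared.
    have h0 : 0 ≤ Real.cos (Real.pi / ((m : ℝ) + 2)) := by
      refine Real.cos_nonneg_of_neg_pi_div_two_le_of_le ?_ ?_
      · have : 0 ≤ Real.pi / ((m : ℝ) + 2) := by positivity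
        linarith [Real.pi_pos]
      · exact div_le_div_of_nonneg_left Real.pi_pos.le two_pos
          (by linarith [m.cast_nonneg (α := ℝ)])
    nlinarith
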